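/- Conventions. A \emph{distribution} $\Delta\subset TM$ on a smooth (finite-dimensional, Hausdorff) manifold is a smooth subbundle. Its weak derived flag is given by the modules of sections $\Gamma(\Delta_1)=\Gamma(\Delta)$, $\Gamma(\Delta_{i+1})=\Gamma(\Delta_i)+[\Gamma(\Delta),\Gamma(\Delta_i)]$ (with $\Delta_0=0$); $\Delta_i(x)\subset T_xM$ is the space of values at $x$ of the fields in $\Gamma(\Delta_i)$. $\Delta$ is \emph{regular} if the dimension of $\Delta_i(x)$ does not depend on $x$ for every $i$, and \emph{completely non-holonomic} if $\Delta_r=TM$ for some $r$. The \emph{Carnot algebra} of a regular $\Delta$ at $x$ is the graded Lie algebra $\mathfrak m=\bigoplus_{i\ge1}g_{-i}$, $g_{-i}=\Delta_i(x)/\Delta_{i-1}(x)$ (equivalently, the fibre at $x$ of $\bigoplus_i\Gamma(\Delta_i)/\Gamma(\Delta_{i-1})$), with the bracket induced by the commutator of vector fields. An \emph{integrable extension} $\pi:(\tilde M,\tilde\Delta)\to(M,\Delta)$ is a smooth submersion $\pi:\tilde M\to M$ such that for every $x\in\tilde M$ the differential $d_x\pi$ restricts to an isomorphism $\tilde\Delta(x)\to\Delta(\pi(x))$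 and $\tilde\Delta_2(x)\cap\operatorname{Ker}d_x\pi=0$. When $\Delta$ is completely non-holonomic, it is called \emph{non-trivial} if $\tilde\Delta$ is completely non-holonomic as well. A GNLA is a finite-dimensional real Lie algebra with a grading $\mathfrak m=\bigoplus_{i\ge1}g_{-i}$, $[g_{-i},g_{-j}]\subset g_{-i-j}$ (it is automatically nilpotent); it is \emph{fundamental} if $g_{-1}$ generates it. For graded Lie algebras $\tilde{\mathfrak m},\mathfrak m$ as above, a $d$-dimensional \emph{central extension of pure grading} $-k$ is an exact sequence $0\to\mathfrak a\to\tilde{\mathfrak m}\xrightarrow{\varpi}\mathfrak m\to0$ in which $\varpi$ is a homomorphism of graded Lie algebras, and $\mathfrak a$ is $d$-dimensional, central and contained in the component $\tilde g_{-k}$; it is \emph{nontrivial} if the sequence of Lie algebras does not split. The \emph{flat model} of a GNLA $\mathfrak m$ is the simply connected Lie group with Lie algebra $\mathfrak m$, with the left-invariant distribution spanned by the left-invariant vector fields in $g_{-1}$. Theorem. 1. Let $\pi:(\tilde M,\tilde\Delta)\to(M,\Delta)$ be a non-trivial integrable extension of regular, completely non-holonomic distributions. Let $x\in\tilde M$ and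 $d=\dim\operatorname{Ker}d_x\pi$. Suppose that the tangent space $\mathfrak v=\operatorname{Ker}d_x\pi$ of the fibre has pure grading $-k$ with $k>2$, i.e. $\mathfrak v\subset\tilde\Delta_k(x)$ and $\mathfrak v\cap\tilde\Delta_{k-1}(x)=0$. Then the Carnot algebra $\tilde{\mathfrak m}$ of $\tilde\Delta$ at $x$ is a $d$-dimensional central extension, of pure grading $-k$, of the Carnot algebra $\mathfrak m$ of $\Delta$ at $\pi(x)$; the projection $\tilde{\mathfrak m}\to\mathfrak m$ can be taken to be the map induced by $d_x\pi$. 2. Conversely, let $\varpi:\tilde{\mathfrak m}\to\mathfrak m$ be a nontrivial $d$-dimensional central extension of pure grading $-k$, $k>2$, of GNLAs, with $\mathfrak m$ fundamental, and let $(\tilde M,\tilde\Delta)$ and $(M,\Delta)$ be the flat models of $\tilde{\mathfrak m}$ and $\mathfrak m$. Then there is an integrable extension $\pi:(\tilde M,\tilde\Delta)\to(M,\Delta)$; it can be taken to be a homomorphism of Lie groups whose differential maps the left-invariant field of each $X\in\tilde{\mathfrak m}$ to that of $\varpi(X)$. If $\tilde{\mathfrak m}$ is fundamental too, then $\tilde\Delta$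 is completely non-holonomic. -/

import Mathlib

open scoped Manifold ContDiff DirectSum

noncomputable section

section VectorFields

variable (E : Type*) [NormedAddCommGroup E] [NormedSpace ℝ E]
  (M : Type*) [TopologicalSpace M] [ChartedSpace E M] [IsManifold 𝓘(ℝ, E) ∞ M]

/-- The real vector space of smooth (`C^∞`) vector fields on `M`. -/
def SmoothVF : Submodule ℝ (∀ x : M, TangentSpace 𝓘(ℝ, E) x) where
  carrier := {X | ContMDiff 𝓘(ℝ, E) 𝓘(ℝ, E).tangent ∞
    (fun x => (⟨x, X x⟩ : TangentBundle 𝓘(ℝ, E) M))}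
  add_mem' hX hY := hX.add_section hY
  zero_mem' := Bundle.contMDiff_zeroSection ℝ (TangentSpace 𝓘(ℝ, E) : M → Type _)
  smul_mem' c _ hX := hX.const_smul_section (a := c)

variable {E M}

theorem SmoothVF.contMDiff (X : SmoothVF E M) : ContMDiff 𝓘(ℝ, E) 𝓘(ℝ, E).tangent ∞
    (fun x => (⟨x, X.1 x⟩ : TangentBundle 𝓘(ℝ, E) M)) := X.2

theorem SmoothVF.mdifferentiableAt (X : SmoothVF E M) (x : M) :
    MDifferentiableAt 𝓘(ℝ, E) 𝓘(ℝ, E).tangent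
    (fun x => (⟨x, X.1 x⟩ : TangentBundle 𝓘(ℝ, E) M)) x :=
  (SmoothVF.contMDiff X x).mdifferentiableAt (by simp)

/-- The product of a smooth function and a smooth vector field. -/
def SmoothVF.fsmul (f : C^∞⟮𝓘(ℝ, E), M; ℝ⟯) (X : SmoothVF E M) : SmoothVF E M :=
  ⟨fun x => f x • X.1 x, f.contMDiff.smul_section (SmoothVF.contMDiff X)⟩

/-- The derivative `X f` of a smooth function along a smooth vector field. -/
def SmoothVF.deriv (X : SmoothVF E M) (f : C^∞⟮𝓘(ℝ, E), M; ℝ⟯) : C^∞⟮𝓘(ℝ, E), M; ℝ⟯ :=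
  ⟨fun x => mvfderiv 𝓘(ℝ, E) f x (X.1 x), by
    have h1 : ContMDiff 𝓘(ℝ, E).tangent 𝓘(ℝ, ℝ).tangent ∞ (tangentMap 𝓘(ℝ, E) 𝓘(ℝ, ℝ) f) :=
      f.contMDiff.contMDiff_tangentMap (by simp)
    exact (contMDiff_snd_tangentBundle_modelSpace ℝ 𝓘(ℝ, ℝ)).comp (h1.comp (SmoothVF.contMDiff X))⟩

variable [FiniteDimensional ℝ E]

/-- The commutator of smooth vector fields. -/
instance : Bracket (SmoothVF E M) (SmoothVF E M) where
  bracket X Y := ⟨VectorField.mlieBracket 𝓘(ℝ, E) X.1 Y.1, by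
    have : CompleteSpace E := FiniteDimensional.complete ℝ E
    have : IsManifold 𝓘(ℝ, E) (((⊤ : ℕ∞) : WithTop ℕ∞) + 1) M := by
      simpa using (inferInstance : IsManifold 𝓘(ℝ, E) ∞ M)
    have : IsManifold 𝓘(ℝ, E) (minSmoothness ℝ 2) M := by
      simpa using (inferInstance : IsManifold 𝓘(ℝ, E) 2 M)
    exact ContDiff.mlieBracket_vectorField (m := ⊤) (n := ⊤) X.2 Y.2 (by simp)⟩

theorem SmoothVF.lie_apply (X Y : SmoothVF E M) (x : M) :
    (⁅X, Y⁆ : SmoothVF E M).1 x = VectorField.mlieBracket 𝓘(ℝ, E) X.1 Y.1 x := rfl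

instance : LieRing (SmoothVF E M) where
  add_lie X Y Z := by
    have : CompleteSpace E := FiniteDimensional.complete ℝ E
    ext x; exact VectorField.mlieBracket_add_left (SmoothVF.mdifferentiableAt X x) (SmoothVF.mdifferentiableAt Y x)
  lie_add X Y Z := by
    have : CompleteSpace E := FiniteDimensional.complete ℝ E
    ext x; exact VectorField.mlieBracket_add_right (SmoothVF.mdifferentiableAt Y x) (SmoothVF.mdifferentiableAt Z x)
  lie_self X := by
    ext x; simp [SmoothVF.lie_apply]
  leibniz_lie X Y Z := by
    have : CompleteSpace E := FiniteDimensional.complete ℝ E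
    have : IsManifold 𝓘(ℝ, E) (minSmoothness ℝ 3) M := by
      simpa using (inferInstance : IsManifold 𝓘(ℝ, E) 3 M)
    have le2 : minSmoothness ℝ 2 ≤ ∞ := by
      simpa using (ENat.LEInfty.out : (2 : WithTop ℕ∞) ≤ ∞)
    ext x
    exact VectorField.leibniz_identity_mlieBracket_apply
      ((SmoothVF.contMDiff X x).of_le le2) ((SmoothVF.contMDiff Y x).of_le le2)
      ((SmoothVF.contMDiff Z x).of_le le2)

instance : LieAlgebra ℝ (SmoothVF E M) where
  lie_smul c X Y := by
    have : CompleteSpace E := FiniteDimensional.complete ℝ E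
    ext x; exact VectorField.mlieBracket_const_smul_right (SmoothVF.mdifferentiableAt Y x)

theorem SmoothVF.lie_fsmul (X Y : SmoothVF E M) (f : C^∞⟮𝓘(ℝ, E), M; ℝ⟯) :
    ⁅X, SmoothVF.fsmul f Y⁆ = SmoothVF.fsmul (SmoothVF.deriv X f) Y + SmoothVF.fsmul f ⁅X, Y⁆ := by
  have : CompleteSpace E := FiniteDimensional.complete ℝ E
  ext x
  exact VectorField.mlieBracket_smul_right
    ((f.contMDiff x).mdifferentiableAt (by simp)) (SmoothVF.mdifferentiableAt Y x)


variable (E M) in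
/-- A (smooth, constant rank) distribution on `M`: subspaces `Δ x ⊆ T_x M` of one dimension, such
that every vector of `Δ x` extends to a smooth vector field tangent to `Δ`. -/
structure TangentDistribution where
  /-- the subspace of `T_x M` -/
  space : ∀ x : M, Submodule ℝ (TangentSpace 𝓘(ℝ, E) x)
  finrank_eq : ∀ x y, Module.finrank ℝ (space x) = Module.finrank ℝ (space y)
  exists_section : ∀ x, ∀ v ∈ space x, ∃ X : SmoothVF E M, (∀ y, X.1 y ∈ space y) ∧ X.1 x = v

namespace TangentDistribution

variable (Δ : TangentDistribution E M)

/-- The module `Γ(Δ)` of smooth sections of `Δ`. -/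
def sections : Submodule ℝ (SmoothVF E M) where
  carrier := {X | ∀ y, X.1 y ∈ Δ.space y}
  add_mem' hX hY y := (Δ.space y).add_mem (hX y) (hY y)
  zero_mem' y := (Δ.space y).zero_mem
  smul_mem' c _ hX y := (Δ.space y).smul_mem c (hX y)

/-- The modules `Γ(Δ_i)` of the weak derived flag: `Γ(Δ_1) = Γ(Δ)` and
`Γ(Δ_{i+1}) = Γ(Δ_i) + [Γ(Δ), Γ(Δ_i)]`; by convention `Γ(Δ_0) = 0`. -/
def flagSections : ℕ → Submodule ℝ (SmoothVF E M)
  | 0 => ⊥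
  | 1 => Δ.sections
  | n + 2 => flagSections (n + 1) ⊔
      Submodule.span ℝ {Z | ∃ X ∈ Δ.sections, ∃ Y ∈ flagSections (n + 1), Z = ⁅X, Y⁆}

/-- The subspace `Δ_i(x)` of `T_x M`: the values at `x` of the fields in `Γ(Δ_i)`. -/
def flag (i : ℕ) (x : M) : Submodule ℝ (TangentSpace 𝓘(ℝ, E) x) :=
  ((Δ.flagSections i).map (SmoothVF E M).subtype).map (LinearMap.proj x)

/-- `Δ` is regular: the terms of the weak derived flag have constant rank. -/
def IsRegular : Prop :=
  ∀ i x y, Module.finrank ℝ (Δ.flag i x) = Module.finrank ℝ (Δ.flag i y)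

/-- `Δ` is completely non-holonomic: `Δ_k = TM` for some `k`. -/
def IsCompletelyNonholonomic : Prop :=
  ∃ k, ∀ x, Δ.flag k x = ⊤

theorem flagSections_le_succ (n : ℕ) : Δ.flagSections n ≤ Δ.flagSections (n + 1) := by
  rcases n with _ | n
  · exact bot_le
  · exact le_sup_left

theorem flagSections_mono : Monotone Δ.flagSections :=
  monotone_nat_of_le_succ Δ.flagSections_le_succ

theorem lie_sections_mem {n : ℕ} {X Y : SmoothVF E M} (hX : X ∈ Δ.sections)
    (hY : Y ∈ Δ.flagSections n) : ⁅X, Y⁆ ∈ Δ.flagSections (n + 1) := by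
  rcases n with _ | n
  · obtain rfl : Y = 0 := by simpa [flagSections] using hY
    simp
  · exact Submodule.mem_sup_right (Submodule.subset_span ⟨X, hX, Y, hY, rfl⟩)

theorem fsmul_mem_sections (f : C^∞⟮𝓘(ℝ, E), M; ℝ⟯) {X : SmoothVF E M} (hX : X ∈ Δ.sections) :
    SmoothVF.fsmul f X ∈ Δ.sections :=
  fun y => (Δ.space y).smul_mem _ (hX y)

variable (E M) in
/-- Multiplication by a smooth function as a linear map on vector fields. -/
def _root_.SmoothVF.fsmulₗ (f : C^∞⟮𝓘(ℝ, E), M; ℝ⟯) : SmoothVF E M →ₗ[ℝ] SmoothVF E M where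
  toFun := SmoothVF.fsmul f
  map_add' X Y := by ext x; exact smul_add _ _ _
  map_smul' c X := by ext x; exact smul_comm _ _ _

theorem fsmul_mem (n : ℕ) (f : C^∞⟮𝓘(ℝ, E), M; ℝ⟯) {X : SmoothVF E M}
    (hX : X ∈ Δ.flagSections n) : SmoothVF.fsmul f X ∈ Δ.flagSections n := by
  induction n generalizing f X with
  | zero =>
    obtain rfl : X = 0 := by simpa [flagSections] using hX
    have h : SmoothVF.fsmul f (0 : SmoothVF E M) = 0 := (SmoothVF.fsmulₗ E M f).map_zero
    rw [h]; exact Submodule.zero_mem _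
  | succ n ih =>
    rcases n with _ | n
    · exact Δ.fsmul_mem_sections f hX
    · have key : Δ.flagSections (n + 2) ≤
          (Δ.flagSections (n + 2)).comap (SmoothVF.fsmulₗ E M f) := by
        refine sup_le (fun Y hY => Submodule.mem_sup_left (ih f hY)) (Submodule.span_le.2 ?_)
        rintro _ ⟨Y, hY, Z, hZ, rfl⟩
        have h1 : SmoothVF.fsmul f ⁅Y, Z⁆ =
            ⁅Y, SmoothVF.fsmul f Z⁆ - SmoothVF.fsmul (SmoothVF.deriv Y f) Z := by
          rw [SmoothVF.lie_fsmul]; abel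
        change SmoothVF.fsmul f ⁅Y, Z⁆ ∈ Δ.flagSections (n + 2)
        rw [h1]
        exact Submodule.sub_mem _ (Δ.lie_sections_mem hY (ih f hZ))
          (Δ.flagSections_le_succ _ (ih _ hZ))
      exact key hX

theorem lie_mem {i j : ℕ} {X Y : SmoothVF E M} (hX : X ∈ Δ.flagSections i)
    (hY : Y ∈ Δ.flagSections j) : ⁅X, Y⁆ ∈ Δ.flagSections (i + j) := by
  induction i generalizing j X Y with
  | zero =>
    obtain rfl : X = 0 := by simpa [flagSections] using hX
    simp
  | succ i ih =>
    rcases i with _ | i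
    · rw [zero_add, add_comm]; exact Δ.lie_sections_mem hX hY
    · let ad : SmoothVF E M →ₗ[ℝ] SmoothVF E M := (LieModule.toEnd ℝ (SmoothVF E M) (SmoothVF E M) Y)
      have key : Δ.flagSections (i + 2) ≤ (Δ.flagSections (i + 2 + j)).comap ad := by
        refine sup_le (fun A hA => ?_) (Submodule.span_le.2 ?_)
        · change ⁅Y, A⁆ ∈ Δ.flagSections (i + 2 + j)
          rw [← lie_skew]
          exact Submodule.neg_mem _ (Δ.flagSections_mono (by omega) (ih hA hY))
        · rintro _ ⟨A, hA, B, hB, rfl⟩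
          change ⁅Y, ⁅A, B⁆⁆ ∈ Δ.flagSections (i + 2 + j)
          rw [← lie_skew, lie_lie]
          refine Submodule.neg_mem _ (Submodule.sub_mem _ ?_ ?_)
          · exact Δ.flagSections_mono (by omega) (Δ.lie_sections_mem hA (ih hB hY))
          · exact Δ.flagSections_mono (by omega) (ih hB (Δ.lie_sections_mem hA hY))
      have h := key hX
      change ⁅Y, X⁆ ∈ Δ.flagSections (i + 2 + j) at h
      rw [← lie_skew]
      exact Submodule.neg_mem _ h

/-! ### The Carnot algebra -/

/-- The submodule `Γ(Δ_{i-1}) + 𝔪_x Γ(Δ_i)` of `Γ(Δ_i)`, where `𝔪_x` is the ideal of smooth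
functions vanishing at `x`. -/
def fiberKer (x : M) (i : ℕ) : Submodule ℝ (SmoothVF E M) :=
  Δ.flagSections (i - 1) ⊔ Submodule.span ℝ
    {Z | ∃ f : C^∞⟮𝓘(ℝ, E), M; ℝ⟯, f x = 0 ∧ ∃ X ∈ Δ.flagSections i, Z = SmoothVF.fsmul f X}

theorem flagSections_le_fiberKer (x : M) {i j : ℕ} (h : i + 1 ≤ j) :
    Δ.flagSections i ≤ Δ.fiberKer x j :=
  le_trans (Δ.flagSections_mono (by omega)) le_sup_left

theorem lie_mem_fiberKer (x : M) {i j : ℕ} {X Y : SmoothVF E M} (hX : X ∈ Δ.flagSections i)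
    (hY : Y ∈ Δ.fiberKer x j) : ⁅X, Y⁆ ∈ Δ.fiberKer x (i + j) := by
  rcases i with _ | i
  · obtain rfl : X = 0 := by simpa [flagSections] using hX
    simp
  let ad : SmoothVF E M →ₗ[ℝ] SmoothVF E M := (LieModule.toEnd ℝ (SmoothVF E M) (SmoothVF E M) X)
  have key : Δ.fiberKer x j ≤ (Δ.fiberKer x (i + 1 + j)).comap ad := by
    refine sup_le (fun A hA => ?_) (Submodule.span_le.2 ?_)
    · change ⁅X, A⁆ ∈ Δ.fiberKer x (i + 1 + j)
      rcases j with _ | j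
      · obtain rfl : A = 0 := by simpa [flagSections] using hA
        simp
      · exact Δ.flagSections_le_fiberKer x (by omega) (Δ.lie_mem hX hA)
    · rintro _ ⟨f, hf, A, hA, rfl⟩
      change ⁅X, SmoothVF.fsmul f A⁆ ∈ Δ.fiberKer x (i + 1 + j)
      rw [SmoothVF.lie_fsmul]
      refine Submodule.add_mem _ ?_ ?_
      · exact Δ.flagSections_le_fiberKer x (by omega) (Δ.fsmul_mem j _ hA)
      · exact Submodule.mem_sup_right
          (Submodule.subset_span ⟨f, hf, _, Δ.lie_mem hX hA, rfl⟩)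
  exact key hY

/-- The component `g_{-i}(x)` of the Carnot algebra at `x`: the fibre at `x` of the quotient module
`Γ(Δ_i) / Γ(Δ_{i-1})`. (For a regular distribution, evaluation at `x` identifies it with
`Δ_i(x) / Δ_{i-1}(x)`.) -/
def CarnotPiece (x : M) (i : ℕ) : Type _ :=
  Δ.flagSections i ⧸ (Δ.fiberKer x i).submoduleOf (Δ.flagSections i)

instance (x : M) (i : ℕ) : AddCommGroup (Δ.CarnotPiece x i) :=
  inferInstanceAs (AddCommGroup
    (Δ.flagSections i ⧸ (Δ.fiberKer x i).submoduleOf (Δ.flagSections i)))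

instance (x : M) (i : ℕ) : Module ℝ (Δ.CarnotPiece x i) :=
  inferInstanceAs (Module ℝ
    (Δ.flagSections i ⧸ (Δ.fiberKer x i).submoduleOf (Δ.flagSections i)))

/-- The quotient map `Γ(Δ_i) → g_{-i}(x)`. -/
def pieceMk (x : M) (i : ℕ) : Δ.flagSections i →ₗ[ℝ] Δ.CarnotPiece x i :=
  Submodule.mkQ ((Δ.fiberKer x i).submoduleOf (Δ.flagSections i))

/-- The Carnot algebra `⨁ g_{-i}(x)` of `Δ` at `x`. -/
def Carnot (x : M) : Type _ := ⨁ i, Δ.CarnotPiece x i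

instance (x : M) : AddCommGroup (Δ.Carnot x) :=
  inferInstanceAs (AddCommGroup (⨁ i, Δ.CarnotPiece x i))

instance (x : M) : Module ℝ (Δ.Carnot x) :=
  inferInstanceAs (Module ℝ (⨁ i, Δ.CarnotPiece x i))

/-- The class in `g_{-i}(x)` of a field in `Γ(Δ_i)`. -/
def cls (x : M) (i : ℕ) : Δ.flagSections i →ₗ[ℝ] Δ.Carnot x :=
  DirectSum.lof ℝ ℕ (Δ.CarnotPiece x) i ∘ₗ Δ.pieceMk x i

theorem cls_eq_zero (x : M) {i : ℕ} {X : Δ.flagSections i} (h : X.1 ∈ Δ.fiberKer x i) :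
    Δ.cls x i X = 0 := by
  have h1 : Δ.pieceMk x i X = 0 :=
    (Submodule.Quotient.mk_eq_zero _).2 h
  change DirectSum.lof ℝ ℕ (Δ.CarnotPiece x) i (Δ.pieceMk x i X) = 0
  rw [h1, map_zero]

theorem cls_congr (x : M) {i j : ℕ} (h : i = j) {X : Δ.flagSections i} {Y : Δ.flagSections j}
    (hXY : X.1 = Y.1) : Δ.cls x i X = Δ.cls x j Y := by
  subst h
  rw [Subtype.ext hXY]

@[elab_as_elim]
theorem carnot_induction (x : M) {p : Δ.Carnot x → Prop} (zero : p 0)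
    (cls : ∀ i X, p (Δ.cls x i X)) (add : ∀ a b, p a → p b → p (a + b)) (a : Δ.Carnot x) : p a := by
  refine DirectSum.induction_on a zero (fun i q => ?_) add
  obtain ⟨X, rfl⟩ := Submodule.mkQ_surjective _ q
  exact cls i X

/-- The commutator `Γ(Δ_i) × Γ(Δ_j) → Γ(Δ_{i+j})`, followed by the class at `x`. -/
def preBracket (x : M) (i j : ℕ) : Δ.flagSections i →ₗ[ℝ] Δ.flagSections j →ₗ[ℝ] Δ.Carnot x :=
  LinearMap.mk₂ ℝ (fun X Y => Δ.cls x (i + j) ⟨⁅X.1, Y.1⁆, Δ.lie_mem X.2 Y.2⟩)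
    (fun X X' Y => by
      rw [← map_add]; exact Δ.cls_congr x rfl (add_lie X.1 X'.1 Y.1))
    (fun c X Y => by
      rw [← map_smul]; exact Δ.cls_congr x rfl (smul_lie c X.1 Y.1))
    (fun X Y Y' => by
      rw [← map_add]; exact Δ.cls_congr x rfl (lie_add X.1 Y.1 Y'.1))
    (fun c X Y => by
      rw [← map_smul]; exact Δ.cls_congr x rfl (lie_smul c X.1 Y.1))

/-- The bracket `g_{-i}(x) × g_{-j}(x) → g_{-i-j}(x)` induced by the commutator. -/
def pieceBracket (x : M) (i j : ℕ) :
    Δ.CarnotPiece x i →ₗ[ℝ] Δ.CarnotPiece x j →ₗ[ℝ] Δ.Carnot x :=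
  Submodule.liftQ _
    { toFun := fun X => Submodule.liftQ _ (Δ.preBracket x i j X) (fun Y hY => by
        exact Δ.cls_eq_zero x (Δ.lie_mem_fiberKer x X.2 hY))
      map_add' := fun X X' => by
        refine Submodule.linearMap_qext _ (LinearMap.ext fun Y => ?_)
        exact LinearMap.map_add₂ (Δ.preBracket x i j) X X' Y
      map_smul' := fun c X => by
        refine Submodule.linearMap_qext _ (LinearMap.ext fun Y => ?_)
        exact LinearMap.map_smul₂ (Δ.preBracket x i j) c X Y }
    (fun X hX => by
      refine Submodule.linearMap_qext _ (LinearMap.ext fun Y => ?_)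
      refine Δ.cls_eq_zero x ?_
      change ⁅X.1, Y.1⁆ ∈ Δ.fiberKer x (i + j)
      rw [← lie_skew, add_comm]
      exact Submodule.neg_mem _ (Δ.lie_mem_fiberKer x Y.2 hX))

/-- The bracket of the Carnot algebra as a bilinear map. -/
def carnotBracket (x : M) : Δ.Carnot x →ₗ[ℝ] Δ.Carnot x →ₗ[ℝ] Δ.Carnot x :=
  DirectSum.toModule ℝ ℕ _ fun i => LinearMap.flip
    (DirectSum.toModule ℝ ℕ _ fun j => (Δ.pieceBracket x i j).flip)

theorem carnotBracket_cls (x : M) (i j : ℕ) (X : Δ.flagSections i) (Y : Δ.flagSections j) :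
    Δ.carnotBracket x (Δ.cls x i X) (Δ.cls x j Y) =
      Δ.cls x (i + j) ⟨⁅X.1, Y.1⁆, Δ.lie_mem X.2 Y.2⟩ := by
  simp only [carnotBracket, cls, LinearMap.comp_apply]
  erw [DirectSum.toModule_lof, LinearMap.flip_apply, DirectSum.toModule_lof]
  rfl

instance (x : M) : Bracket (Δ.Carnot x) (Δ.Carnot x) where
  bracket a b := Δ.carnotBracket x a b

theorem lie_cls (x : M) (i j : ℕ) (X : Δ.flagSections i) (Y : Δ.flagSections j) :
    ⁅Δ.cls x i X, Δ.cls x j Y⁆ = Δ.cls x (i + j) ⟨⁅X.1, Y.1⁆, Δ.lie_mem X.2 Y.2⟩ :=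
  Δ.carnotBracket_cls x i j X Y

theorem carnotBracket_skew (x : M) (a b : Δ.Carnot x) :
    Δ.carnotBracket x a b = - Δ.carnotBracket x b a := by
  induction a using Δ.carnot_induction x with
  | zero => simp
  | add a a' h h' => simp only [map_add, LinearMap.add_apply, h, h', neg_add]
  | cls i X =>
    induction b using Δ.carnot_induction x with
    | zero => simp
    | add a a' h h' => simp only [map_add, LinearMap.add_apply, h, h', neg_add]
    | cls j Y =>
      rw [carnotBracket_cls, carnotBracket_cls, ← map_neg]
      exact Δ.cls_congr x (add_comm _ _) (lie_skew X.1 Y.1).symm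

instance (x : M) : LieRing (Δ.Carnot x) where
  add_lie a b c := LinearMap.map_add₂ (Δ.carnotBracket x) a b c
  lie_add a b c := map_add (Δ.carnotBracket x a) b c
  lie_self a := by
    have h : Δ.carnotBracket x a a = 0 := by
      have h := Δ.carnotBracket_skew x a a
      have h2 : (2 : ℝ) • Δ.carnotBracket x a a = 0 := by
        rw [two_smul]; exact add_eq_zero_iff_eq_neg.2 h
      exact (smul_eq_zero.1 h2).resolve_left two_ne_zero
    exact h
  leibniz_lie a b c := by
    change Δ.carnotBracket x a (Δ.carnotBracket x b c) =
      Δ.carnotBracket x (Δ.carnotBracket x a b) c + Δ.carnotBracket x b (Δ.carnotBracket x a c)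
    induction a using Δ.carnot_induction x with
    | zero => simp
    | add a a' h h' => simp only [map_add, LinearMap.add_apply, h, h']; abel
    | cls i X =>
    induction b using Δ.carnot_induction x with
    | zero => simp
    | add a a' h h' => simp only [map_add, LinearMap.add_apply, h, h']; abel
    | cls j Y =>
    induction c using Δ.carnot_induction x with
    | zero => simp
    | add a a' h h' => simp only [map_add, h, h']; abel
    | cls k Z =>
    simp only [carnotBracket_cls]
    have h1 : (⁅X.1, ⁅Y.1, Z.1⁆⁆ : SmoothVF E M) ∈ Δ.flagSections (i + (j + k)) :=
      Δ.lie_mem X.2 (Δ.lie_mem Y.2 Z.2)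
    have h2 : (⁅⁅X.1, Y.1⁆, Z.1⁆ : SmoothVF E M) ∈ Δ.flagSections (i + (j + k)) :=
      add_assoc i j k ▸ Δ.lie_mem (Δ.lie_mem X.2 Y.2) Z.2
    have h3 : (⁅Y.1, ⁅X.1, Z.1⁆⁆ : SmoothVF E M) ∈ Δ.flagSections (i + (j + k)) :=
      add_left_comm i j k ▸ Δ.lie_mem Y.2 (Δ.lie_mem X.2 Z.2)
    rw [Δ.cls_congr x (add_assoc i j k) (Y := ⟨_, h2⟩) rfl,
      Δ.cls_congr x (add_left_comm j i k) (Y := ⟨_, h3⟩) rfl, ← map_add]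
    exact Δ.cls_congr x rfl (leibniz_lie X.1 Y.1 Z.1)

instance (x : M) : LieAlgebra ℝ (Δ.Carnot x) where
  lie_smul c a b := map_smul (Δ.carnotBracket x a) c b

end TangentDistribution

end VectorFields

/-- A grading of a real Lie algebra by negative degrees; `piece i` is the component `g_{-i}`.
A finite-dimensional Lie algebra with such a grading (which is then nilpotent) is a
graded nilpotent Lie algebra (GNLA). -/
structure NegGrading (𝔪 : Type*) [LieRing 𝔪] [LieAlgebra ℝ 𝔪] where
  /-- the component of degree `-i` -/
  piece : ℕ → Submodule ℝ 𝔪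
  piece_zero : piece 0 = ⊥
  lie_mem : ∀ {i j : ℕ} {x y : 𝔪}, x ∈ piece i → y ∈ piece j → ⁅x, y⁆ ∈ piece (i + j)
  isInternal : DirectSum.IsInternal piece

namespace NegGrading

variable {𝔪 : Type*} [LieRing 𝔪] [LieAlgebra ℝ 𝔪] (G : NegGrading 𝔪)

/-- The grading is fundamental: `g_{-1}` generates the Lie algebra. -/
def IsFundamental : Prop := LieSubalgebra.lieSpan ℝ 𝔪 (G.piece 1) = ⊤

/-- The projection of `𝔪` onto `g_{-i}`. -/
def proj (i : ℕ) : 𝔪 →ₗ[ℝ] 𝔪 :=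
  (G.piece i).subtype ∘ₗ DirectSum.component ℝ ℕ (fun i => G.piece i) i ∘ₗ
    (LinearEquiv.ofBijective (DirectSum.coeLinearMap G.piece) G.isInternal).symm.toLinearMap

theorem proj_mem (i : ℕ) (v : 𝔪) : G.proj i v ∈ G.piece i := Subtype.property _

theorem proj_of_mem {i : ℕ} {v : 𝔪} (h : v ∈ G.piece i) : G.proj i v = v :=
  congrArg Subtype.val (G.isInternal.ofBijective_coeLinearMap_of_mem h)

theorem proj_of_mem_ne {i j : ℕ} (hij : i ≠ j) {v : 𝔪} (h : v ∈ G.piece i) : G.proj j v = 0 :=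
  congrArg Subtype.val (G.isInternal.ofBijective_coeLinearMap_of_mem_ne hij h)

theorem piece_induction {p : 𝔪 → Prop} (zero : p 0) (add : ∀ a b, p a → p b → p (a + b))
    (mem : ∀ i, ∀ v ∈ G.piece i, p v) (v : 𝔪) : p v := by
  have h : v ∈ ⨆ i, G.piece i := by rw [G.isInternal.submodule_iSup_eq_top]; trivial
  exact Submodule.iSup_induction G.piece (motive := p) h mem zero add

theorem eq_zero_of_proj {v : 𝔪} (h : ∀ i, G.proj i v = 0) : v = 0 := by
  have h1 : (LinearEquiv.ofBijective (DirectSum.coeLinearMap G.piece) G.isInternal).symm v = 0 := by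
    ext i; exact h i
  simpa using h1

/-- The filtration `⨁_{i ≥ n} g_{-i}`. -/
def fil (n : ℕ) : Submodule ℝ 𝔪 := ⨅ i, ⨅ _ : i < n, LinearMap.ker (G.proj i)

theorem mem_fil {n : ℕ} {v : 𝔪} : v ∈ G.fil n ↔ ∀ i < n, G.proj i v = 0 := by
  simp [fil]

theorem piece_le_fil {i n : ℕ} (h : n ≤ i) : G.piece i ≤ G.fil n := fun _ hv =>
  G.mem_fil.2 fun _ hj => G.proj_of_mem_ne (by omega) hv

theorem fil_anti {i n : ℕ} (h : n ≤ i) : G.fil i ≤ G.fil n := fun _ hv =>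
  G.mem_fil.2 fun j hj => G.mem_fil.1 hv j (by omega)

theorem proj_zero_apply (v : 𝔪) : G.proj 0 v = 0 := by
  have h := G.proj_mem 0 v
  rwa [G.piece_zero, Submodule.mem_bot] at h

theorem mem_fil_one (v : 𝔪) : v ∈ G.fil 1 := G.mem_fil.2 fun i hi => by
  obtain rfl : i = 0 := by omega
  exact G.proj_zero_apply v

variable [FiniteDimensional ℝ 𝔪]

theorem exists_depth : ∃ N : ℕ, ∀ n, N ≤ n → G.piece n = ⊥ := by
  have h := WellFoundedGT.finite_ne_bot_of_iSupIndep G.isInternal.submodule_iSupIndep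
  obtain ⟨N, hN⟩ := h.bddAbove
  refine ⟨N + 1, fun n hn => ?_⟩
  by_contra hne
  have := hN hne
  omega

/-- A bound on the degrees: `g_{-n} = 0` for `n ≥ depth`. -/
def depth : ℕ := G.exists_depth.choose

theorem piece_eq_bot {n : ℕ} (h : G.depth ≤ n) : G.piece n = ⊥ := G.exists_depth.choose_spec n h

theorem sum_proj (v : 𝔪) : ∑ i ∈ Finset.range G.depth, G.proj i v = v := by
  refine G.piece_induction (p := fun v => ∑ i ∈ Finset.range G.depth, G.proj i v = v)
    (by simp) (fun a b ha hb => ?_) (fun j v hv => ?_) v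
  · simp only [map_add, Finset.sum_add_distrib, ha, hb]
  · by_cases hj : G.depth ≤ j
    · rw [G.piece_eq_bot hj, Submodule.mem_bot] at hv
      simp [hv]
    · rw [Finset.sum_eq_single j (fun i _ hij => G.proj_of_mem_ne (Ne.symm hij) hv)
        (fun h => absurd (Finset.mem_range.2 (by omega)) h), G.proj_of_mem hv]

theorem lie_mem_fil {a b : ℕ} {v w : 𝔪} (hv : v ∈ G.fil a) (hw : w ∈ G.fil b) :
    ⁅v, w⁆ ∈ G.fil (a + b) := by
  rw [← G.sum_proj v, ← G.sum_proj w, lie_sum]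
  refine Submodule.sum_mem _ fun j _ => ?_
  rw [sum_lie]
  refine Submodule.sum_mem _ fun i _ => ?_
  by_cases hi : i < a
  · simp [G.mem_fil.1 hv i hi]
  by_cases hj : j < b
  · simp [G.mem_fil.1 hw j hj]
  exact G.piece_le_fil (by omega) (G.lie_mem (G.proj_mem i v) (G.proj_mem j w))

/-- The grading derivation, equal to `i` on `g_{-i}`. -/
def degree : 𝔪 →ₗ[ℝ] 𝔪 := ∑ i ∈ Finset.range G.depth, (i : ℝ) • G.proj i

theorem degree_of_mem {i : ℕ} {v : 𝔪} (hv : v ∈ G.piece i) : G.degree v = (i : ℝ) • v := by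
  by_cases hj : G.depth ≤ i
  · rw [G.piece_eq_bot hj, Submodule.mem_bot] at hv
    simp [hv]
  · simp only [degree, LinearMap.sum_apply, LinearMap.smul_apply]
    rw [Finset.sum_eq_single i (fun j _ hij => by rw [G.proj_of_mem_ne (Ne.symm hij) hv, smul_zero])
        (fun h => absurd (Finset.mem_range.2 (by omega)) h), G.proj_of_mem hv]

theorem degree_lie (v w : 𝔪) : G.degree ⁅v, w⁆ = ⁅G.degree v, w⁆ + ⁅v, G.degree w⁆ := by
  induction v using G.piece_induction with
  | zero => simp
  | add a b ha hb => simp only [add_lie, map_add, ha, hb]; abel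
  | mem i v hv =>
  induction w using G.piece_induction with
  | zero => simp
  | add a b ha hb => simp only [lie_add, map_add, ha, hb]; abel
  | mem j w hw =>
  rw [G.degree_of_mem hv, G.degree_of_mem hw, G.degree_of_mem (G.lie_mem hv hw), smul_lie,
    lie_smul, ← add_smul, Nat.cast_add]

theorem proj_degree (i : ℕ) (v : 𝔪) : G.proj i (G.degree v) = (i : ℝ) • G.proj i v := by
  induction v using G.piece_induction with
  | zero => simp
  | add a b ha hb => simp only [map_add, ha, hb, smul_add]
  | mem j v hv =>
    rw [G.degree_of_mem hv, map_smul]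
    by_cases h : j = i
    · rw [h]
    · rw [G.proj_of_mem_ne h hv, smul_zero, smul_zero]

theorem eq_zero_of_fil {v : 𝔪} (n : ℕ) (h : ∀ j, n ≤ j → v ∈ G.fil j) : v = 0 :=
  G.eq_zero_of_proj fun i => G.mem_fil.1 (h (max n (i + 1)) (le_max_left _ _)) i (by omega)

/-- An eigenvector of `degree - ad u` of eigenvalue `n` without components in degrees `≤ n`
vanishes. -/
theorem eq_zero_of_eigen (u : 𝔪) {w : 𝔪} {n : ℕ} (h : G.degree w - ⁅u, w⁆ = (n : ℝ) • w)
    (hw : w ∈ G.fil (n + 1)) : w = 0 := by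
  refine G.eq_zero_of_fil (n + 1) fun j hj => ?_
  induction j, hj using Nat.le_induction with
  | base => exact hw
  | succ j hj ih =>
    refine G.mem_fil.2 fun i hi => ?_
    rcases Nat.lt_succ_iff_lt_or_eq.1 hi with hi | rfl
    · exact G.mem_fil.1 ih i hi
    · have h1 : G.proj i ⁅u, w⁆ = 0 := G.mem_fil.1 (G.lie_mem_fil (G.mem_fil_one u) ih) i (by omega)
      have h2 := congrArg (G.proj i) h
      rw [map_sub, h1, sub_zero, G.proj_degree, map_smul] at h2
      have h3 : ((i : ℝ) - n) • G.proj i w = 0 := by rw [sub_smul, h2, sub_self]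
      refine (smul_eq_zero.1 h3).resolve_left ?_
      have : (n : ℝ) < i := by exact_mod_cast hj
      linarith

/-- The components of `frame u`: `frameAux u s` maps `g_{-i}` to `g_{-i-s}`. -/
def frameAux (u : 𝔪) : ℕ → (𝔪 →ₗ[ℝ] 𝔪)
  | 0 => LinearMap.id
  | s + 1 => ((s : ℝ) + 1)⁻¹ • ∑ l : Fin (s + 1),
      (LieAlgebra.ad ℝ 𝔪 (G.proj (l + 1) u)) ∘ₗ frameAux u (s - l)
  decreasing_by omega

theorem frameAux_succ (u : 𝔪) (s : ℕ) : G.frameAux u (s + 1) = ((s : ℝ) + 1)⁻¹ •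
    ∑ l : Fin (s + 1), (LieAlgebra.ad ℝ 𝔪 (G.proj (l + 1) u)) ∘ₗ G.frameAux u (s - l) := by
  rw [frameAux]

theorem frameAux_mem (u : 𝔪) (s : ℕ) {i : ℕ} {v : 𝔪} (hv : v ∈ G.piece i) :
    G.frameAux u s v ∈ G.piece (i + s) := by
  induction s using Nat.strong_induction_on with
  | _ s ih =>
  rcases s with _ | s
  · rw [frameAux]; exact hv
  · rw [frameAux_succ, LinearMap.smul_apply, LinearMap.sum_apply]
    refine Submodule.smul_mem _ _ (Submodule.sum_mem _ fun l _ => ?_)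
    have h := G.lie_mem (G.proj_mem (l + 1) u) (ih (s - l) (by omega))
    have e : (l : ℕ) + 1 + (i + (s - l)) = i + (s + 1) := by omega
    rw [e] at h
    exact h

theorem frameAux_eq_zero (u : 𝔪) {s : ℕ} (hs : G.depth ≤ s) : G.frameAux u s = 0 := by
  ext v
  induction v using G.piece_induction with
  | zero => simp
  | add a b ha hb => rw [map_add, ha, hb, map_add]
  | mem i v hv =>
    have h := G.frameAux_mem u s hv
    rwa [G.piece_eq_bot (by omega), Submodule.mem_bot] at h

theorem smul_frameAux (u : 𝔪) (n : ℕ) (v : 𝔪) : (n : ℝ) • G.frameAux u n v =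
    ∑ q ∈ Finset.HasAntidiagonal.antidiagonal n, ⁅G.proj q.1 u, G.frameAux u q.2 v⁆ := by
  rcases n with _ | s
  · simp [proj_zero_apply]
  · rw [frameAux_succ, Finset.Nat.antidiagonal_succ, Finset.sum_cons, Finset.sum_map]
    simp only [proj_zero_apply, zero_lie, zero_add]
    rw [Finset.Nat.sum_antidiagonal_eq_sum_range_succ_mk, LinearMap.smul_apply, smul_smul,
      Nat.cast_succ, mul_inv_cancel₀ (by positivity), one_smul, LinearMap.sum_apply]
    exact Fin.sum_univ_eq_sum_range (fun l => ⁅G.proj (l + 1) u, G.frameAux u (s - l) v⁆) (s + 1)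

/-- The unipotent automorphism `A_u` of `𝔪` that conjugates the grading derivation to
`degree - ad u`. -/
def frame (u : 𝔪) : 𝔪 →ₗ[ℝ] 𝔪 := ∑ s ∈ Finset.range G.depth, G.frameAux u s

theorem frame_apply (u v : 𝔪) {N : ℕ} (hN : G.depth ≤ N) :
    G.frame u v = ∑ s ∈ Finset.range N, G.frameAux u s v := by
  rw [frame, LinearMap.sum_apply]
  refine Finset.sum_subset (Finset.range_mono hN) fun s _ hs => ?_
  rw [G.frameAux_eq_zero u (by simpa using hs)]; rfl

theorem frame_comm (u v : 𝔪) :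
    G.degree (G.frame u v) - ⁅u, G.frame u v⁆ = G.frame u (G.degree v) := by
  induction v using G.piece_induction with
  | zero => simp
  | add a b ha hb => simp only [map_add, lie_add, ← ha, ← hb]; abel
  | mem i v hv =>
  set N := G.depth with hN
  have h1 : ⁅u, G.frame u v⁆ = ∑ n ∈ Finset.range N, (n : ℝ) • G.frameAux u n v := by
    have h2 : ⁅u, G.frame u v⁆ = ∑ q ∈ Finset.range N ×ˢ Finset.range N,
        ⁅G.proj q.1 u, G.frameAux u q.2 v⁆ := by
      rw [Finset.sum_product]
      conv_lhs => rw [← G.sum_proj u, sum_lie]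
      refine Finset.sum_congr rfl fun l _ => ?_
      rw [G.frame_apply (N := N) _ _ le_rfl, G.sum_proj, lie_sum]
    rw [h2]
    have h3 : ∑ q ∈ Finset.range N ×ˢ Finset.range N, ⁅G.proj q.1 u, G.frameAux u q.2 v⁆ =
        ∑ q ∈ (Finset.range N ×ˢ Finset.range N).filter (fun q => q.1 + q.2 < N),
          ⁅G.proj q.1 u, G.frameAux u q.2 v⁆ := by
      symm
      refine Finset.sum_subset (Finset.filter_subset _ _) fun q hq hq' => ?_
      have h4 := G.lie_mem (G.proj_mem q.1 u) (G.frameAux_mem u q.2 hv)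
      have h5 : N ≤ q.1 + q.2 := by
        by_contra hlt
        exact hq' (Finset.mem_filter.2 ⟨hq, by omega⟩)
      rwa [G.piece_eq_bot (by omega), Submodule.mem_bot] at h4
    rw [h3, ← Finset.sum_fiberwise_of_maps_to (t := Finset.range N) (g := fun q : ℕ × ℕ => q.1 + q.2)
      (fun q hq => Finset.mem_range.2 (Finset.mem_filter.1 hq).2)]
    refine Finset.sum_congr rfl fun n hn => ?_
    rw [smul_frameAux]
    refine Finset.sum_congr ?_ fun _ _ => rfl
    ext ⟨a, b⟩
    simp only [Finset.mem_filter, Finset.mem_product, Finset.mem_range,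
      Finset.HasAntidiagonal.mem_antidiagonal] at hn ⊢
    omega
  rw [h1, G.frame_apply u v (N := N) le_rfl, G.degree_of_mem hv, map_smul,
    G.frame_apply u v (N := N) le_rfl, map_sum, Finset.smul_sum, ← Finset.sum_sub_distrib]
  refine Finset.sum_congr rfl fun s _ => ?_
  rw [G.degree_of_mem (G.frameAux_mem u s hv), Nat.cast_add, add_smul, add_sub_cancel_right]

theorem frame_sub_mem (u : 𝔪) {n : ℕ} {v : 𝔪} (hv : v ∈ G.fil n) :
    G.frame u v - v ∈ G.fil (n + 1) := by
  have key : ∀ i, ∀ w ∈ G.piece i, G.frame u w - w ∈ G.fil (i + 1) := by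
    intro i w hw
    rw [G.frame_apply u w (Nat.le_succ _), Finset.sum_range_succ']
    have : G.frameAux u 0 w = w := by rw [frameAux]; rfl
    rw [this, add_sub_cancel_right]
    refine Submodule.sum_mem _ fun s _ => ?_
    exact G.piece_le_fil (by omega) (G.frameAux_mem u (s + 1) hw)
  have h : G.frame u v - v = ∑ i ∈ Finset.range G.depth,
      (G.frame u (G.proj i v) - G.proj i v) := by
    rw [Finset.sum_sub_distrib, ← map_sum, G.sum_proj]
  rw [h]
  refine Submodule.sum_mem _ fun i _ => ?_
  by_cases hi : i < n
  · simp [G.mem_fil.1 hv i hi]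
  · exact G.fil_anti (by omega) (key i _ (G.proj_mem i v))

theorem frame_mem_fil (u : 𝔪) {n : ℕ} {v : 𝔪} (hv : v ∈ G.fil n) : G.frame u v ∈ G.fil n := by
  have h := Submodule.add_mem _ (G.fil_anti (Nat.le_succ n) (G.frame_sub_mem u hv)) hv
  rwa [sub_add_cancel] at h

theorem frame_zero : G.frame 0 = LinearMap.id := by
  ext v
  induction v using G.piece_induction with
  | zero => simp
  | add a b ha hb => simp only [map_add, ha, hb]
  | mem i v hv =>
    refine sub_eq_zero.1 (G.eq_zero_of_eigen 0 (n := i) ?_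
      (G.frame_sub_mem 0 (G.piece_le_fil le_rfl hv)))
    have h := G.frame_comm 0 v
    rw [zero_lie, sub_zero, G.degree_of_mem hv, map_smul] at h
    simp only [LinearMap.id_apply, zero_lie, sub_zero, map_sub, h, G.degree_of_mem hv, smul_sub]

theorem frame_lie (u v w : 𝔪) : G.frame u ⁅v, w⁆ = ⁅G.frame u v, G.frame u w⁆ := by
  induction v using G.piece_induction with
  | zero => simp
  | add a b ha hb => simp only [add_lie, map_add, ha, hb]
  | mem i v hv =>
  induction w using G.piece_induction with
  | zero => simp
  | add a b ha hb => simp only [lie_add, map_add, ha, hb]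
  | mem j w hw =>
  refine sub_eq_zero.1 (G.eq_zero_of_eigen u (n := i + j) ?_ ?_)
  · have hv' := G.frame_comm u v
    have hw' := G.frame_comm u w
    have hvw := G.frame_comm u ⁅v, w⁆
    rw [G.degree_of_mem hv, map_smul, sub_eq_iff_eq_add] at hv'
    rw [G.degree_of_mem hw, map_smul, sub_eq_iff_eq_add] at hw'
    rw [G.degree_of_mem (G.lie_mem hv hw), map_smul, sub_eq_iff_eq_add] at hvw
    rw [map_sub, hvw, G.degree_lie, hv', hw', lie_sub, smul_sub]
    simp only [add_lie, lie_add, smul_lie, lie_smul, lie_lie u, Nat.cast_add, add_smul]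
    rw [leibniz_lie u (G.frame u v)]
    abel
  · have e : G.frame u ⁅v, w⁆ - ⁅G.frame u v, G.frame u w⁆ = (G.frame u ⁅v, w⁆ - ⁅v, w⁆) -
        (⁅G.frame u v - v, G.frame u w⁆ + ⁅v, G.frame u w - w⁆) := by
      simp only [sub_lie, lie_sub]; abel
    have hv' := G.piece_le_fil le_rfl hv
    have hw' := G.piece_le_fil le_rfl hw
    rw [e]
    refine Submodule.sub_mem _ (G.frame_sub_mem u (G.piece_le_fil le_rfl (G.lie_mem hv hw)))
      (Submodule.add_mem _ ?_ ?_)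
    · exact G.fil_anti (by omega) (G.lie_mem_fil (G.frame_sub_mem u hv') (G.frame_mem_fil u hw'))
    · exact G.fil_anti (by omega) (G.lie_mem_fil hv' (G.frame_sub_mem u hw'))

theorem frame_add_frame (u v w : 𝔪) :
    G.frame (u + G.frame u v) w = G.frame u (G.frame v w) := by
  induction w using G.piece_induction with
  | zero => simp
  | add a b ha hb => simp only [map_add, ha, hb]
  | mem i w hw =>
  refine sub_eq_zero.1 (G.eq_zero_of_eigen (u + G.frame u v) (n := i) ?_ ?_)
  · have h1 := G.frame_comm (u + G.frame u v) w
    have h2 := G.frame_comm v w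
    have h3 := G.frame_comm u (G.frame v w)
    rw [G.degree_of_mem hw, map_smul] at h1 h2
    rw [sub_eq_iff_eq_add.1 h2, map_add, map_smul, G.frame_lie] at h3
    rw [map_sub, lie_sub, sub_sub_sub_comm, h1, add_lie, sub_add_eq_sub_sub, h3, smul_sub]
    abel
  · have hw' := G.piece_le_fil le_rfl hw
    have e : G.frame (u + G.frame u v) w - G.frame u (G.frame v w) =
        (G.frame (u + G.frame u v) w - w) - (G.frame u (G.frame v w) - G.frame v w)
          - (G.frame v w - w) := by abel
    rw [e]
    exact Submodule.sub_mem _ (Submodule.sub_mem _ (G.frame_sub_mem _ hw')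
      (G.frame_sub_mem _ (G.frame_mem_fil _ hw'))) (G.frame_sub_mem _ hw')

theorem frame_injective (u : 𝔪) : Function.Injective (G.frame u) := by
  refine (injective_iff_map_eq_zero _).2 fun v hv => ?_
  refine G.eq_zero_of_fil 0 fun j hj => ?_
  clear hj
  induction j with
  | zero => exact G.mem_fil.2 fun i hi => absurd hi (by omega)
  | succ j ih =>
    have h := G.frame_sub_mem u ih
    rw [hv, zero_sub] at h
    exact (Submodule.neg_mem_iff _).1 h

/-- `A_u` as a linear automorphism. -/
def frameEquiv (u : 𝔪) : 𝔪 ≃ₗ[ℝ] 𝔪 := LinearEquiv.ofInjectiveEndo (G.frame u) (G.frame_injective u)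

theorem degree_injective : Function.Injective G.degree := by
  refine (injective_iff_map_eq_zero _).2 fun v hv => G.eq_zero_of_proj fun i => ?_
  have h := G.proj_degree i v
  rw [hv, map_zero] at h
  rcases i with _ | i
  · exact G.proj_zero_apply v
  · exact (smul_eq_zero.1 h.symm).resolve_left (by positivity)

end NegGrading

namespace NegGrading

variable {𝔪 : Type*} [LieRing 𝔪] [LieAlgebra ℝ 𝔪] [FiniteDimensional ℝ 𝔪] (G : NegGrading 𝔪)

/-- The vector space `𝔪` with an (auxiliary) norm. -/
@[nolint unusedArguments]
def Space (_ : NegGrading 𝔪) : Type _ := 𝔪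

instance : AddCommGroup G.Space := inferInstanceAs (AddCommGroup 𝔪)
instance : Module ℝ G.Space := inferInstanceAs (Module ℝ 𝔪)
instance : FiniteDimensional ℝ G.Space := inferInstanceAs (FiniteDimensional ℝ 𝔪)

/-- Coordinates on `𝔪`. -/
def coord : G.Space ≃ₗ[ℝ] (Fin (Module.finrank ℝ 𝔪) → ℝ) := (Module.finBasis ℝ 𝔪).equivFun

instance : NormedAddCommGroup G.Space :=
  NormedAddCommGroup.induced G.Space (Fin (Module.finrank ℝ 𝔪) → ℝ) G.coord.toLinearMap
    G.coord.injective

instance : NormedSpace ℝ G.Space :=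
  NormedSpace.induced ℝ G.Space (Fin (Module.finrank ℝ 𝔪) → ℝ) G.coord.toLinearMap

instance : CompleteSpace G.Space := FiniteDimensional.complete ℝ G.Space

/-- The identity map `𝔪 → G.Space`. -/
def toSpace : 𝔪 ≃ₗ[ℝ] G.Space := LinearEquiv.refl ℝ 𝔪

/-- An endomorphism of `𝔪` as a continuous linear map. -/
def clm : (𝔪 →ₗ[ℝ] 𝔪) →ₗ[ℝ] (G.Space →L[ℝ] G.Space) :=
  (LinearMap.toContinuousLinearMap (𝕜 := ℝ) (E := G.Space) (F' := G.Space)).toLinearMap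

/-- The bracket of `𝔪` as a continuous bilinear map. -/
def adL : G.Space →L[ℝ] G.Space →L[ℝ] G.Space :=
  LinearMap.toContinuousLinearMap
    (G.clm ∘ₗ (LieModule.toEnd ℝ 𝔪 𝔪 : 𝔪 →ₗ[ℝ] Module.End ℝ 𝔪) : G.Space →ₗ[ℝ] _)

theorem clm_frameAux_zero (u : 𝔪) : G.clm (G.frameAux u 0) = ContinuousLinearMap.id ℝ _ := by
  rw [frameAux]; rfl

theorem clm_frameAux_succ (u : 𝔪) (s : ℕ) : G.clm (G.frameAux u (s + 1)) = ((s : ℝ) + 1)⁻¹ •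
    ∑ l : Fin (s + 1), ((G.adL.comp (G.clm (G.proj (l + 1)))) (G.toSpace u)).comp
      (G.clm (G.frameAux u (s - l))) := by
  rw [frameAux_succ, map_smul, map_sum]
  rfl

theorem contDiff_frameAux (n : WithTop ℕ∞) (s : ℕ) :
    ContDiff ℝ n (fun u : G.Space => G.clm (G.frameAux u s)) := by
  induction s using Nat.strong_induction_on with
  | _ s ih =>
  rcases s with _ | s
  · have : (fun u : G.Space => G.clm (G.frameAux u 0)) =
        fun _ => ContinuousLinearMap.id ℝ _ := funext fun u => G.clm_frameAux_zero u
    rw [this]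
    exact contDiff_const
  · have h := funext fun u : G.Space => G.clm_frameAux_succ u s
    refine h ▸ ContDiff.const_smul _ (ContDiff.sum fun l _ => ?_)
    exact (ContinuousLinearMap.contDiff _).clm_comp (ih _ (by omega))

/-- `A_u` as a continuous linear map. -/
def frameL (u : G.Space) : G.Space →L[ℝ] G.Space := G.clm (G.frame u)

theorem contDiff_frameL (n : WithTop ℕ∞) : ContDiff ℝ n G.frameL := by
  have h : G.frameL = fun u => ∑ s ∈ Finset.range G.depth, G.clm (G.frameAux u s) := by
    funext u; exact map_sum G.clm _ _
  rw [h]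
  exact ContDiff.sum fun s _ => G.contDiff_frameAux n s

/-- The product of the group `G.FlatModel`. -/
def mulFun (u v : 𝔪) : 𝔪 := u + G.frame u v

/-- The inversion of the group `G.FlatModel`. -/
def invFun (u : 𝔪) : 𝔪 := -(G.frameEquiv u).symm u

theorem mulFun_assoc (u v w : 𝔪) :
    G.mulFun (G.mulFun u v) w = G.mulFun u (G.mulFun v w) := by
  simp only [mulFun, frame_add_frame, map_add, add_assoc]

theorem mulFun_zero (u : 𝔪) : G.mulFun u 0 = u := by simp [mulFun]

theorem mulFun_invFun (u : 𝔪) : G.mulFun u (G.invFun u) = 0 := by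
  have h : G.frame u ((G.frameEquiv u).symm u) = u := (G.frameEquiv u).apply_symm_apply u
  simp [mulFun, invFun, h]

/-- The simply connected nilpotent Lie group with Lie algebra `𝔪`, realized on the vector space
`𝔪`: the product is `u * v = u + A_u v`. -/
def FlatModel : Type _ := G.Space

instance : TopologicalSpace G.FlatModel := inferInstanceAs (TopologicalSpace G.Space)
instance : ChartedSpace G.Space G.FlatModel := inferInstanceAs (ChartedSpace G.Space G.Space)
instance (n : WithTop ℕ∞) : IsManifold 𝓘(ℝ, G.Space) n G.FlatModel :=
  inferInstanceAs (IsManifold 𝓘(ℝ, G.Space) n G.Space)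

/-- The identity map `G.Space → G.FlatModel`. -/
def toModel : G.Space ≃ G.FlatModel := Equiv.refl _

instance : Mul G.FlatModel := ⟨G.mulFun⟩
instance : One G.FlatModel := ⟨(0 : 𝔪)⟩
instance : Inv G.FlatModel := ⟨G.invFun⟩

instance : Group G.FlatModel :=
  Group.ofRightAxioms G.mulFun_assoc G.mulFun_zero G.mulFun_invFun

theorem contDiff_mul (n : WithTop ℕ∞) :
    ContDiff ℝ n (fun p : G.Space × G.Space => p.1 + G.frameL p.1 p.2) :=
  contDiff_fst.add (((G.contDiff_frameL n).comp contDiff_fst).clm_apply contDiff_snd)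

theorem contDiff_inv (n : WithTop ℕ∞) :
    ContDiff ℝ n (fun u : G.Space => -((G.frameL u).inverse u)) := by
  refine ContDiff.neg (ContDiff.clm_apply ?_ contDiff_id)
  refine contDiff_iff_contDiffAt.2 fun u => ?_
  let e : G.Space ≃L[ℝ] G.Space :=
    LinearEquiv.toContinuousLinearEquiv (E := G.Space) (F := G.Space) (G.frameEquiv u)
  have h : ((e : G.Space ≃L[ℝ] G.Space) : G.Space →L[ℝ] G.Space) = G.frameL u := by
    ext v; rfl
  exact ContDiffAt.comp u (h ▸ contDiffAt_map_inverse e) (G.contDiff_frameL n).contDiffAt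

theorem frameL_inverse (u : G.Space) :
    (G.frameL u).inverse u = (G.frameEquiv u).symm u := by
  let e : G.Space ≃L[ℝ] G.Space :=
    LinearEquiv.toContinuousLinearEquiv (E := G.Space) (F := G.Space) (G.frameEquiv u)
  have h : G.frameL u = ((e : G.Space ≃L[ℝ] G.Space) : G.Space →L[ℝ] G.Space) := by
    ext v; rfl
  rw [h, ContinuousLinearMap.inverse_equiv]
  rfl

instance (n : WithTop ℕ∞) : LieGroup 𝓘(ℝ, G.Space) n G.FlatModel where
  contMDiff_mul := by
    have h := (G.contDiff_mul n).contMDiff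
    rw [modelWithCornersSelf_prod, ← chartedSpaceSelf_prod] at h
    exact h
  contMDiff_inv := by
    have h := (G.contDiff_inv n).contMDiff
    simp only [frameL_inverse] at h
    exact h

/-- Left invariant fields are `u ↦ A_u v`. -/
theorem mulInvariantVectorField_eq (v : G.Space) (u : G.FlatModel) :
    mulInvariantVectorField (I := 𝓘(ℝ, G.Space)) (G := G.FlatModel) v u = G.frameL (G.toModel.symm u) v := by
  have h : HasFDerivAt (fun w : G.Space => G.toModel.symm u + G.frameL (G.toModel.symm u) w)
      (G.frameL (G.toModel.symm u)) 0 :=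
    (G.frameL _).hasFDerivAt.const_add _
  exact congrArg (fun L : G.Space →L[ℝ] G.Space => L v) (h.hasMFDerivAt.mfderiv)

theorem frameAux_zero_left (s : ℕ) : G.frameAux 0 (s + 1) = 0 := by
  rw [frameAux_succ]
  simp

theorem hasFDerivAt_frameAux (s : ℕ) :
    HasFDerivAt (fun u : G.Space => G.clm (G.frameAux u (s + 1)))
      (((s : ℝ) + 1)⁻¹ • G.adL.comp (G.clm (G.proj (s + 1)))) 0 := by
  have h := funext fun u : G.Space => G.clm_frameAux_succ u s
  have hd : ∀ k, DifferentiableAt ℝ (fun u : G.Space => G.clm (G.frameAux u k)) 0 := fun k =>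
    ((G.contDiff_frameAux 1 k).differentiable one_ne_zero).differentiableAt
  have h1 := HasFDerivAt.const_smul (HasFDerivAt.fun_sum (u := Finset.univ)
    fun (l : Fin (s + 1)) _ =>
      ((G.adL.comp (G.clm (G.proj (l + 1)))).hasFDerivAt (x := 0)).clm_comp
        (hd (s - l)).hasFDerivAt) ((s : ℝ) + 1)⁻¹
  rw [h]
  refine h1.congr_fderiv ?_
  congr 1
  have h0 : ∀ l : Fin (s + 1), l ≠ Fin.last s → G.clm (G.frameAux (0 : G.Space) (s - l)) = 0 := by
    intro l hl
    have hlt : (l : ℕ) < s := Fin.val_lt_last hl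
    obtain ⟨k, hk⟩ : ∃ k, s - (l : ℕ) = k + 1 := ⟨s - l - 1, by omega⟩
    rw [hk]
    exact (congrArg G.clm (G.frameAux_zero_left k)).trans (map_zero G.clm)
  rw [Finset.sum_eq_single (Fin.last s)]
  · have hl : G.clm (G.frameAux (0 : G.Space) (s - (Fin.last s : ℕ))) = ContinuousLinearMap.id ℝ _ := by
      rw [Fin.val_last, Nat.sub_self]
      exact G.clm_frameAux_zero 0
    ext x y
    have := congrArg (fun L => (G.adL (G.clm (G.proj (s + 1)) x)) (L y)) hl
    simpa using this
  · intro l _ hl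
    ext x y
    have := congrArg (fun L => (G.adL (G.clm (G.proj (l + 1)) x)) (L y)) (h0 l hl)
    simpa using this
  · exact fun h => absurd (Finset.mem_univ _) h

/-- The inverse of the grading derivation. -/
def degreeInv : 𝔪 →ₗ[ℝ] 𝔪 := ∑ i ∈ Finset.range G.depth, (i : ℝ)⁻¹ • G.proj i

theorem degreeInv_of_mem {i : ℕ} {v : 𝔪} (hv : v ∈ G.piece i) :
    G.degreeInv v = (i : ℝ)⁻¹ • v := by
  by_cases hj : G.depth ≤ i
  · rw [G.piece_eq_bot hj, Submodule.mem_bot] at hv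
    simp [hv]
  · simp only [degreeInv, LinearMap.sum_apply, LinearMap.smul_apply]
    rw [Finset.sum_eq_single i (fun j _ hij => by rw [G.proj_of_mem_ne (Ne.symm hij) hv, smul_zero])
        (fun h => absurd (Finset.mem_range.2 (by omega)) h), G.proj_of_mem hv]

theorem degreeInv_degree (v : 𝔪) : G.degreeInv (G.degree v) = v := by
  induction v using G.piece_induction with
  | zero => simp
  | add a b ha hb => simp only [map_add, ha, hb]
  | mem i v hv =>
    rw [G.degree_of_mem hv, map_smul, G.degreeInv_of_mem hv, smul_smul]
    rcases i with _ | i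
    · rw [G.piece_zero, Submodule.mem_bot] at hv
      simp [hv]
    · rw [mul_inv_cancel₀ (by positivity), one_smul]

/-- The grading derivation as a linear automorphism. -/
def degreeEquiv : 𝔪 ≃ₗ[ℝ] 𝔪 := LinearEquiv.ofInjectiveEndo G.degree G.degree_injective

theorem hasFDerivAt_frameL : HasFDerivAt G.frameL (G.adL.comp (G.clm G.degreeInv)) 0 := by
  have h : G.frameL = fun u => ContinuousLinearMap.id ℝ _ +
      ∑ s ∈ Finset.range G.depth, G.clm (G.frameAux u (s + 1)) := by
    funext u
    have h1 : G.frame u = ∑ s ∈ Finset.range (G.depth + 1), G.frameAux u s := by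
      ext v; rw [G.frame_apply u v (Nat.le_succ _), LinearMap.sum_apply]
    have h2 : G.frameL u = G.clm (∑ s ∈ Finset.range (G.depth + 1), G.frameAux u s) :=
      congrArg G.clm h1
    rw [h2, map_sum, Finset.sum_range_succ', add_comm]
    exact congrArg (· + _) (G.clm_frameAux_zero u)
  have h3 : G.degreeInv = ∑ s ∈ Finset.range G.depth, ((s : ℝ) + 1)⁻¹ • G.proj (s + 1) := by
    have h4 : G.proj G.depth = 0 := by
      ext v
      have h5 := G.proj_mem G.depth v
      rwa [G.piece_eq_bot le_rfl, Submodule.mem_bot] at h5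
    have h5 := Finset.sum_range_succ (fun i : ℕ => (i : ℝ)⁻¹ • G.proj i) G.depth
    rw [h4, smul_zero, add_zero] at h5
    rw [degreeInv, ← h5, Finset.sum_range_succ']
    simp
  rw [h]
  refine ((HasFDerivAt.fun_sum fun s _ => G.hasFDerivAt_frameAux s).const_add _).congr_fderiv ?_
  rw [h3, map_sum]
  ext x y
  simp

theorem lieBracket_frameL (v w : G.Space) :
    VectorField.lieBracket ℝ (fun u => G.frameL u v) (fun u => G.frameL u w) 0 =
      G.adL (G.clm G.degreeInv v) w - G.adL (G.clm G.degreeInv w) v := by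
  have h0 : ∀ x, G.frameL 0 x = x := fun x => congrArg (fun L : 𝔪 →ₗ[ℝ] 𝔪 => L x) G.frame_zero
  have h1 : ∀ x, HasFDerivAt (fun u => G.frameL u x)
      ((G.adL.comp (G.clm G.degreeInv)).flip x) 0 := fun x => by
    have := G.hasFDerivAt_frameL.clm_apply (hasFDerivAt_const x (0 : G.Space))
    simpa using this
  rw [VectorField.lieBracket, (h1 w).fderiv, (h1 v).fderiv, h0, h0]
  rfl

theorem mlieBracket_mulInvariant (v w : G.Space) :
    VectorField.mlieBracket 𝓘(ℝ, G.Space)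
      (mulInvariantVectorField (I := 𝓘(ℝ, G.Space)) (G := G.FlatModel) v)
      (mulInvariantVectorField (I := 𝓘(ℝ, G.Space)) (G := G.FlatModel) w) 1 =
      VectorField.lieBracket ℝ (fun u => G.frameL u v) (fun u => G.frameL u w) 0 := by
  rw [funext (G.mulInvariantVectorField_eq v), funext (G.mulInvariantVectorField_eq w)]
  have h := congrFun (VectorField.mlieBracketWithin_eq_lieBracketWithin (𝕜 := ℝ) (E := G.Space)
    (V := fun u => G.frameL u v) (W := fun u => G.frameL u w) (s := Set.univ)) 0
  rw [VectorField.lieBracketWithin_univ] at h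
  exact (congrFun (VectorField.mlieBracketWithin_univ) _).symm.trans h

/-- The Lie algebra of the group `G.FlatModel` is `𝔪`; the identification is `degree`, under the
identification of the tangent space at `1` with `𝔪`. -/
def lieEquiv : 𝔪 ≃ₗ⁅ℝ⁆ GroupLieAlgebra 𝓘(ℝ, G.Space) G.FlatModel :=
  { (G.degreeEquiv.trans G.toSpace : 𝔪 ≃ₗ[ℝ] G.Space) with
    map_lie' := by
      intro X Y
      have h1 : G.degree ⁅X, Y⁆ = ⁅X, G.degree Y⁆ - ⁅Y, G.degree X⁆ := by
        rw [G.degree_lie, ← lie_skew (G.degree X)]; abel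
      have h2 := G.lieBracket_frameL (G.degree X) (G.degree Y)
      have h3 : G.adL (G.clm G.degreeInv (G.degree X)) (G.degree Y) -
          G.adL (G.clm G.degreeInv (G.degree Y)) (G.degree X) =
          (⁅X, G.degree Y⁆ - ⁅Y, G.degree X⁆ : 𝔪) := by
        change (⁅G.degreeInv (G.degree X), G.degree Y⁆ -
          ⁅G.degreeInv (G.degree Y), G.degree X⁆ : 𝔪) = _
        rw [degreeInv_degree, degreeInv_degree]
      have h4 := G.mlieBracket_mulInvariant (G.degree X) (G.degree Y)
      exact h1.trans (h4.trans (h2.trans h3)).symm }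

end NegGrading

/-! ### The Carnot algebra as a graded Lie algebra -/

namespace TangentDistribution

variable {E : Type*} [NormedAddCommGroup E] [NormedSpace ℝ E] [FiniteDimensional ℝ E]
  {M : Type*} [TopologicalSpace M] [ChartedSpace E M] [IsManifold 𝓘(ℝ, E) ∞ M]
  (Δ : TangentDistribution E M)

/-- The projection of the Carnot algebra onto the component `g_{-i}(x)`. -/
def carnotComponent (x : M) (i : ℕ) : Δ.Carnot x →ₗ[ℝ] Δ.CarnotPiece x i :=
  DirectSum.component ℝ ℕ (Δ.CarnotPiece x) i

theorem carnotComponent_cls (x : M) (i : ℕ) (X : Δ.flagSections i) :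
    Δ.carnotComponent x i (Δ.cls x i X) = Δ.pieceMk x i X :=
  DirectSum.component.lof_self (R := ℝ) (M := Δ.CarnotPiece x) i (Δ.pieceMk x i X)

theorem carnotComponent_cls_ne (x : M) {i j : ℕ} (h : j ≠ i) (X : Δ.flagSections j) :
    Δ.carnotComponent x i (Δ.cls x j X) = 0 := by
  refine (DirectSum.component.of (R := ℝ) (M := Δ.CarnotPiece x) i j (Δ.pieceMk x j X)).trans ?_
  rw [dif_neg h]

/-- The grading of the Carnot algebra, with components `g_{-i}(x)`. -/
def carnotGrading (x : M) : NegGrading (Δ.Carnot x) where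
  piece i := LinearMap.range (Δ.cls x i)
  piece_zero := by
    refine (LinearMap.range_eq_bot).2 (LinearMap.ext fun X => ?_)
    exact Δ.cls_eq_zero x (Submodule.mem_sup_left X.2)
  lie_mem := by
    rintro i j _ _ ⟨X, rfl⟩ ⟨Y, rfl⟩
    exact ⟨_, (Δ.lie_cls x i j X Y).symm⟩
  isInternal := by
    rw [DirectSum.isInternal_submodule_iff_iSupIndep_and_iSup_eq_top]
    constructor
    · intro i
      rw [Submodule.disjoint_def]
      rintro _ ⟨X, rfl⟩ hX
      have h : (⨆ (j : ℕ) (_ : j ≠ i), LinearMap.range (Δ.cls x j)) ≤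
          LinearMap.ker (Δ.carnotComponent x i) := by
        refine iSup₂_le fun j hj => ?_
        rintro _ ⟨Y, rfl⟩
        exact Δ.carnotComponent_cls_ne x hj Y
      have h1 : Δ.carnotComponent x i (Δ.cls x i X) = 0 := h hX
      rw [carnotComponent_cls] at h1
      change DirectSum.lof ℝ ℕ (Δ.CarnotPiece x) i (Δ.pieceMk x i X) = 0
      rw [h1, map_zero]
    · refine eq_top_iff.2 fun a _ => ?_
      induction a using Δ.carnot_induction x with
      | zero => exact Submodule.zero_mem _
      | add a b ha hb => exact Submodule.add_mem _ (ha trivial) (hb trivial)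
      | cls i X => exact Submodule.mem_iSup_of_mem i ⟨X, rfl⟩

end TangentDistribution

/-! ### Flat models -/

namespace NegGrading

variable {𝔪 : Type*} [LieRing 𝔪] [LieAlgebra ℝ 𝔪] [FiniteDimensional ℝ 𝔪] (G : NegGrading 𝔪)

/-- `X ↦` the value at `u` of the left invariant vector field on the group `G.FlatModel` that
corresponds to `X ∈ 𝔪`. -/
def leftInvariant (u : G.FlatModel) : 𝔪 →ₗ[ℝ] TangentSpace 𝓘(ℝ, G.Space) u where
  toFun X := mulInvariantVectorField (G.lieEquiv X) u
  map_add' X Y := by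
    rw [map_add, mulInvariantVectorField_add]; rfl
  map_smul' c X := by
    rw [map_smul, mulInvariantVectorField_smul]; rfl

theorem leftInvariant_apply (u : G.FlatModel) (X : 𝔪) :
    G.leftInvariant u X = G.frameL (G.toModel.symm u) (G.toSpace (G.degree X)) :=
  G.mulInvariantVectorField_eq _ _

theorem leftInvariant_injective (u : G.FlatModel) : Function.Injective (G.leftInvariant u) := by
  intro X Y h
  rw [leftInvariant_apply, leftInvariant_apply] at h
  exact G.degree_injective (G.frame_injective _ h)

/-- The left invariant vector field that corresponds to `X ∈ 𝔪`. -/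
def leftInvariantField (X : 𝔪) : SmoothVF G.Space G.FlatModel :=
  ⟨fun u => G.leftInvariant u X, by
    have h : ContDiff ℝ ∞ (fun u : G.Space => G.frameL u (G.toSpace (G.degree X))) :=
      (G.contDiff_frameL ∞).clm_apply contDiff_const
    have h1 : ContMDiff 𝓘(ℝ, G.Space) 𝓘(ℝ, G.Space).tangent ∞
        (fun u : G.Space => (⟨u, G.frameL u (G.toSpace (G.degree X))⟩ :
          TangentBundle 𝓘(ℝ, G.Space) G.Space)) :=
      contMDiff_vectorSpace_iff_contDiff.2 h
    have h2 : (fun u : G.FlatModel => G.leftInvariant u X) =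
        fun u => G.frameL (G.toModel.symm u) (G.toSpace (G.degree X)) :=
      funext fun u => G.leftInvariant_apply u X
    change ContMDiff 𝓘(ℝ, G.Space) 𝓘(ℝ, G.Space).tangent ∞
      (fun u => (⟨u, (fun u : G.FlatModel => G.leftInvariant u X) u⟩ :
        TangentBundle 𝓘(ℝ, G.Space) G.FlatModel))
    rw [h2]
    exact h1⟩

/-- The flat model: the left invariant distribution on the group `G.FlatModel` that is spanned by
the left invariant vector fields in `g_{-1}`. -/
def flatDistribution : TangentDistribution G.Space G.FlatModel where
  space u := (G.piece 1).map (G.leftInvariant u)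
  finrank_eq u v :=
    (Submodule.equivMapOfInjective _ (G.leftInvariant_injective u) (G.piece 1)).finrank_eq.symm.trans
      (Submodule.equivMapOfInjective _ (G.leftInvariant_injective v) (G.piece 1)).finrank_eq
  exists_section := by
    rintro u _ ⟨X, hX, rfl⟩
    exact ⟨G.leftInvariantField X, fun v => ⟨X, hX, rfl⟩, rfl⟩

end NegGrading

/-! ### Integrable extensions and central extensions -/

/-- `π : (M', Δ') → (M, Δ)` is an integrable extension: a smooth submersion such that `dπ` maps
`Δ'` isomorphically onto `Δ` and the derived distribution `Δ'_2` meets `ker dπ` trivially. -/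
structure IsIntegrableExtension
    {E' : Type*} [NormedAddCommGroup E'] [NormedSpace ℝ E'] [FiniteDimensional ℝ E']
    {M' : Type*} [TopologicalSpace M'] [ChartedSpace E' M'] [IsManifold 𝓘(ℝ, E') ∞ M']
    {E : Type*} [NormedAddCommGroup E] [NormedSpace ℝ E]
    {M : Type*} [TopologicalSpace M] [ChartedSpace E M] [IsManifold 𝓘(ℝ, E) ∞ M]
    (Δ' : TangentDistribution E' M') (Δ : TangentDistribution E M) (π : M' → M) : Prop where
  contMDiff : ContMDiff 𝓘(ℝ, E') 𝓘(ℝ, E) ∞ π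
  submersion : ∀ x, Function.Surjective (mfderiv 𝓘(ℝ, E') 𝓘(ℝ, E) π x)
  bijOn : ∀ x, Set.BijOn (mfderiv 𝓘(ℝ, E') 𝓘(ℝ, E) π x) (Δ'.space x) (Δ.space (π x))
  flag_two : ∀ x, Disjoint (Δ'.flag 2 x)
    (LinearMap.ker (mfderiv 𝓘(ℝ, E') 𝓘(ℝ, E) π x).toLinearMap)

/-- `p : 𝔫 → 𝔪` exhibits the graded Lie algebra `𝔫` as a `d`-dimensional central extension of the
graded Lie algebra `𝔪` of pure grading `-k`: the sequence `0 → ker p → 𝔫 → 𝔪 → 0` is exact, `p` is a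
morphism of graded Lie algebras, and `ker p` is central, `d`-dimensional and contained in the
component of degree `-k`. -/
structure IsCentralExtension {𝔫 𝔪 : Type*} [LieRing 𝔫] [LieAlgebra ℝ 𝔫] [LieRing 𝔪]
    [LieAlgebra ℝ 𝔪] (H : NegGrading 𝔫) (G : NegGrading 𝔪) (d k : ℕ) (p : 𝔫 →ₗ⁅ℝ⁆ 𝔪) : Prop where
  surjective : Function.Surjective p
  map_piece : ∀ i, ∀ X ∈ H.piece i, p X ∈ G.piece i
  ker_central : p.ker ≤ LieAlgebra.center ℝ 𝔫
  rank_ker : Module.rank ℝ p.ker = d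
  ker_le_piece : ∀ X ∈ p.ker, X ∈ H.piece k

/-- The extension `p : 𝔫 → 𝔪` is trivial: the exact sequence of Lie algebras splits. -/
def IsTrivialExtension {𝔫 𝔪 : Type*} [LieRing 𝔫] [LieAlgebra ℝ 𝔫] [LieRing 𝔪]
    [LieAlgebra ℝ 𝔪] (p : 𝔫 →ₗ⁅ℝ⁆ 𝔪) : Prop :=
  ∃ s : 𝔪 →ₗ⁅ℝ⁆ 𝔫, ∀ X, p (s X) = X

end

/-!
Part 1. Lifting fields of `Δ` along the isomorphisms `Δ'(x) → Δ(π x)` shows that near any point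
`Δ'_i` is generated, over the smooth functions, by fields that are `π`-related to fields of `Δ_i`.
Hence `dπ` maps `Δ'_i(x)` onto `Δ_i(π x)`, and since `π`-relatedness is compatible with brackets it
induces a surjective homomorphism of the Carnot algebras. At a regular point `g_{-i}` is
`Δ_i(x) / Δ_{i-1}(x)`, so that the kernel of the homomorphism is `ker dπ`, placed in degree `-k`.
An ideal that lies in a single degree is central, because brackets lower the degree strictly.

Part 2. In the coordinates of the flat models a graded homomorphism `p` is itself a homomorphism of
Lie groups, whose differential is `p` on left invariant fields. The second derived distribution
`Δ'_2` is contained in `g_{-1} ⊕ g_{-2}`, which meets `ker p ⊆ g_{-k}` trivially as `k > 2`.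
-/

open Filter
open scoped Topology

section DualFamily

variable {K V ι : Type*} [Field K] [AddCommGroup V] [Module K V] [DecidableEq ι] {v : ι → V}

theorem exists_dual_family_of_linearIndependent (hv : LinearIndependent K v) :
    ∃ l : ι → Module.Dual K V, ∀ j i, l j (v i) = (1 : Matrix ι ι K) j i := by
  obtain ⟨r, hr⟩ := (Finsupp.linearCombination K v).exists_leftInverse_of_injective
    (LinearMap.ker_eq_bot.2 hv)
  refine ⟨fun j => Finsupp.lapply j ∘ₗ r, fun j i => ?_⟩
  have hri : r (v i) = Finsupp.single i 1 := by
    simpa using DFunLike.congr_fun hr (Finsupp.single i 1)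
  simp [hri, Finsupp.single_apply, Matrix.one_apply, eq_comm]

variable [Fintype ι] {l : ι → Module.Dual K V}

theorem linearIndependent_of_det_ne_zero
    (h : (Matrix.of fun j i => l j (v i)).det ≠ 0) : LinearIndependent K v := by
  refine Fintype.linearIndependent_iff.2 fun c hc => ?_
  refine congrFun (Matrix.eq_zero_of_mulVec_eq_zero h (funext fun j => ?_))
  simpa [Matrix.mulVec, dotProduct, mul_comm] using congrArg (l j) hc

theorem det_smul_eq_sum_adjugate {u : V} (hu : u ∈ Submodule.span K (Set.range v)) :
    (Matrix.of fun j i => l j (v i)).det • u =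
      ∑ i, ((Matrix.of fun j i => l j (v i)).adjugate.mulVec fun j => l j u) i • v i := by
  obtain ⟨c, rfl⟩ := (Submodule.mem_span_range_iff_exists_fun K).1 hu
  set T := Matrix.of fun j i => l j (v i)
  have hT : (fun j => l j (∑ i, c i • v i)) = T.mulVec c := by
    ext j
    simp [T, Matrix.mulVec, dotProduct, mul_comm]
  simp only [hT, Matrix.mulVec_mulVec, Matrix.adjugate_mul, Matrix.smul_mulVec, Matrix.one_mulVec,
    Pi.smul_apply, smul_assoc, Finset.smul_sum]

end DualFamily

section SmoothFunctions

variable {E : Type*} [NormedAddCommGroup E] [NormedSpace ℝ E] [FiniteDimensional ℝ E]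
  {M : Type*} [TopologicalSpace M] [ChartedSpace E M] [IsManifold 𝓘(ℝ, E) ∞ M] [T2Space M]

theorem exists_smooth_eventuallyEq_one {x : M} {s : Set M} (hs : s ∈ 𝓝 x) :
    ∃ χ : C^∞⟮𝓘(ℝ, E), M; ℝ⟯, χ =ᶠ[𝓝 x] 1 ∧ tsupport χ ⊆ s := by
  obtain ⟨χ, hχ⟩ := (SmoothBumpFunction.nhds_basis_support (I := 𝓘(ℝ, E)) hs).ex_mem
  exact ⟨⟨χ, χ.contMDiff⟩, χ.eventuallyEq_one, hχ⟩

theorem exists_smooth_eventuallyEq {x : M} {f : M → ℝ}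
    (hf : ∀ᶠ z in 𝓝 x, ContMDiffAt 𝓘(ℝ, E) 𝓘(ℝ, ℝ) ∞ f z) :
    ∃ g : C^∞⟮𝓘(ℝ, E), M; ℝ⟯, g =ᶠ[𝓝 x] f := by
  obtain ⟨χ, hχ_one, hχ_supp⟩ := exists_smooth_eventuallyEq_one (E := E) hf
  refine ⟨⟨fun z => χ z * f z, contMDiff_of_tsupport fun z hz => ?_⟩, ?_⟩
  · exact χ.contMDiff.contMDiffAt.mul (hχ_supp (tsupport_mul_subset_left hz))
  · filter_upwards [hχ_one] with z hz
    change χ z * f z = f z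
    rw [hz, Pi.one_apply, one_mul]

theorem exists_smooth_mul_eventuallyEq_one (f : C^∞⟮𝓘(ℝ, E), M; ℝ⟯) {x : M} (hx : f x ≠ 0) :
    ∃ g : C^∞⟮𝓘(ℝ, E), M; ℝ⟯, ∀ᶠ z in 𝓝 x, g z * f z = 1 := by
  have hne : ∀ᶠ z in 𝓝 x, f z ≠ 0 := f.contMDiff.continuous.continuousAt.eventually_ne hx
  obtain ⟨g, hg⟩ := exists_smooth_eventuallyEq (E := E) (x := x) (f := fun z => (f z)⁻¹)
    (hne.mono fun z hz => f.contMDiff.contMDiffAt.inv₀ hz)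
  refine ⟨g, ?_⟩
  filter_upwards [hne, hg] with z hz hgz
  rw [hgz, inv_mul_cancel₀ hz]

theorem exists_smooth_mvfderiv_eq (x : M) (l : Module.Dual ℝ (TangentSpace 𝓘(ℝ, E) x)) :
    ∃ f : C^∞⟮𝓘(ℝ, E), M; ℝ⟯, ∀ v, mvfderiv 𝓘(ℝ, E) f x v = l v := by
  have : IsManifold 𝓘(ℝ, E) 1 M := IsManifold.of_le (n := ∞) (by simp)
  set φ := extChartAt 𝓘(ℝ, E) x
  obtain ⟨e, he⟩ := isInvertible_mfderiv_extChartAt (I := 𝓘(ℝ, E)) (mem_extChartAt_source x)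
  let L : E →L[ℝ] ℝ := LinearMap.toContinuousLinearMap (E := E) (l ∘ₗ e.symm.toLinearMap)
  obtain ⟨f, hf⟩ := exists_smooth_eventuallyEq (E := E) (x := x) (f := fun z => L (φ z)) <| by
    filter_upwards [(chartAt E x).open_source.mem_nhds (mem_chart_source E x)] with z hz
    exact L.contDiff.contDiffAt.comp_contMDiffAt
      (contMDiffOn_extChartAt.contMDiffAt ((chartAt E x).open_source.mem_nhds hz))
  have hφ : MDifferentiableAt 𝓘(ℝ, E) 𝓘(ℝ, E) φ x :=
    mdifferentiableAt_extChartAt (mem_chart_source E x)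
  have hf' : mfderiv 𝓘(ℝ, E) 𝓘(ℝ, ℝ) f x = L ∘L mfderiv 𝓘(ℝ, E) 𝓘(ℝ, E) φ x := by
    rw [hf.mfderiv_eq]
    exact (L.hasMFDerivAt.comp x hφ.hasMFDerivAt).mfderiv
  refine ⟨f, fun v => ?_⟩
  change mfderiv 𝓘(ℝ, E) 𝓘(ℝ, ℝ) f x v = l v
  rw [hf', ← he]
  exact congrArg l (e.symm_apply_apply v)

theorem eq_of_forall_mvfderiv_eq {x : M} {v w : TangentSpace 𝓘(ℝ, E) x}
    (h : ∀ f : C^∞⟮𝓘(ℝ, E), M; ℝ⟯, mvfderiv 𝓘(ℝ, E) f x v = mvfderiv 𝓘(ℝ, E) f x w) : v = w := by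
  refine sub_eq_zero.1 ((Module.forall_dual_apply_eq_zero_iff ℝ (v - w)).1 fun l => ?_)
  obtain ⟨f, hf⟩ := exists_smooth_mvfderiv_eq x l
  rw [map_sub, ← hf, ← hf, h, sub_self]

theorem exists_smooth_dual_family {ι : Type*} [DecidableEq ι] {x : M}
    {v : ι → TangentSpace 𝓘(ℝ, E) x} (hv : LinearIndependent ℝ v) :
    ∃ f : ι → C^∞⟮𝓘(ℝ, E), M; ℝ⟯, (Matrix.of fun j i => mvfderiv 𝓘(ℝ, E) (f j) x (v i)) = 1 := by
  obtain ⟨l, hl⟩ := exists_dual_family_of_linearIndependent hv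
  choose f hf using fun j => exists_smooth_mvfderiv_eq x (l j)
  exact ⟨f, Matrix.ext fun j i => (hf j _).trans (hl j i)⟩

end SmoothFunctions

section Coefficients

variable {E : Type*} [NormedAddCommGroup E] [NormedSpace ℝ E]
  {M : Type*} [TopologicalSpace M] [ChartedSpace E M] [IsManifold 𝓘(ℝ, E) ∞ M]
  {E' : Type*} [NormedAddCommGroup E'] [NormedSpace ℝ E']
  {M' : Type*} [TopologicalSpace M'] [ChartedSpace E' M']
  {g : M' → M}

theorem contMDiff_mvfderiv_along (f : C^∞⟮𝓘(ℝ, E), M; ℝ⟯)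
    {V : ∀ z, TangentSpace 𝓘(ℝ, E) (g z)}
    (hV : ContMDiff 𝓘(ℝ, E') 𝓘(ℝ, E).tangent ∞
      fun z => (⟨g z, V z⟩ : TangentBundle 𝓘(ℝ, E) M)) :
    ContMDiff 𝓘(ℝ, E') 𝓘(ℝ, ℝ) ∞ fun z => mvfderiv 𝓘(ℝ, E) f (g z) (V z) :=
  (contMDiff_snd_tangentBundle_modelSpace ℝ 𝓘(ℝ, ℝ)).comp
    ((f.contMDiff.contMDiff_tangentMap (by simp)).comp hV)

variable [FiniteDimensional ℝ E] [T2Space M] {ι : Type*}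
  {V : ι → ∀ z, TangentSpace 𝓘(ℝ, E) (g z)} {x : M'}

variable (hV : ∀ i, ContMDiff 𝓘(ℝ, E') 𝓘(ℝ, E).tangent ∞
  fun z => (⟨g z, V i z⟩ : TangentBundle 𝓘(ℝ, E) M))

include hV

theorem eventually_linearIndependent_along [Finite ι] (hli : LinearIndependent ℝ fun i => V i x) :
    ∀ᶠ z in 𝓝 x, LinearIndependent ℝ fun i => V i z := by
  classical
  have := Fintype.ofFinite ι
  obtain ⟨h, hx⟩ := exists_smooth_dual_family hli
  let T z : Matrix ι ι ℝ := Matrix.of fun j i => mvfderiv 𝓘(ℝ, E) (h j) (g z) (V i z)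
  have hT : Continuous T := continuous_matrix fun j i =>
    (contMDiff_mvfderiv_along (h j) (hV i)).continuous
  have hTx : (T x).det ≠ 0 := by simp [T, hx]
  filter_upwards [hT.matrix_det.continuousAt.eventually_ne hTx] with z hz
  exact linearIndependent_of_det_ne_zero
    (l := fun j => (mvfderiv 𝓘(ℝ, E) (h j) (g z)).toLinearMap) hz

/- Differentiating along the fields functions on `M` whose differentials at `g x` are dual to the
`V i x` gives a linear system with smooth invertible matrix, which Cramer's rule solves. -/
theorem exists_smooth_coeff_along [Fintype ι] [FiniteDimensional ℝ E']
    [IsManifold 𝓘(ℝ, E') ∞ M'] [T2Space M']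
    (hli : LinearIndependent ℝ fun i => V i x) {U : ∀ z, TangentSpace 𝓘(ℝ, E) (g z)}
    (hU : ContMDiff 𝓘(ℝ, E') 𝓘(ℝ, E).tangent ∞
      fun z => (⟨g z, U z⟩ : TangentBundle 𝓘(ℝ, E) M)) :
    ∃ f : ι → C^∞⟮𝓘(ℝ, E'), M'; ℝ⟯, ∀ᶠ z in 𝓝 x,
      U z ∈ Submodule.span ℝ (Set.range fun i => V i z) → U z = ∑ i, f i z • V i z := by
  classical
  obtain ⟨h, hx⟩ := exists_smooth_dual_family hli
  let T : Matrix ι ι C^∞⟮𝓘(ℝ, E'), M'; ℝ⟯ := Matrix.of fun j i =>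
    ⟨_, contMDiff_mvfderiv_along (h j) (hV i)⟩
  let b : ι → C^∞⟮𝓘(ℝ, E'), M'; ℝ⟯ := fun j => ⟨_, contMDiff_mvfderiv_along (h j) hU⟩
  let ev z : C^∞⟮𝓘(ℝ, E'), M'; ℝ⟯ →+* ℝ := ContMDiffMap.evalRingHom z
  have hT z : (ev z).mapMatrix T =
      Matrix.of fun j i => (mvfderiv 𝓘(ℝ, E) (h j) (g z)).toLinearMap (V i z) := rfl
  have hdet : ev x T.det ≠ 0 := by
    rw [RingHom.map_det, hT]
    exact (congrArg Matrix.det hx).trans Matrix.det_one ▸ one_ne_zero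
  obtain ⟨c, hc⟩ := exists_smooth_mul_eventuallyEq_one T.det hdet
  refine ⟨c • T.adjugate.mulVec b, ?_⟩
  filter_upwards [hc] with z hz hmem
  have hcramer := det_smul_eq_sum_adjugate
    (l := fun j => (mvfderiv 𝓘(ℝ, E) (h j) (g z)).toLinearMap) hmem
  rw [← hT, ← RingHom.map_det, ← RingHom.map_adjugate] at hcramer
  calc U z = c z • ev z T.det • U z := by rw [smul_smul]; exact hz ▸ (one_smul ℝ _).symm
    _ = ∑ i, (c • T.adjugate.mulVec b) i z • V i z := by
      rw [hcramer, Finset.smul_sum]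
      refine Finset.sum_congr rfl fun i _ => ?_
      rw [smul_smul]
      congr 2
      exact (RingHom.map_mulVec (ev z) T.adjugate b i).symm

end Coefficients

namespace SmoothVF

variable {E : Type*} [NormedAddCommGroup E] [NormedSpace ℝ E]
  {M : Type*} [TopologicalSpace M] [ChartedSpace E M] [IsManifold 𝓘(ℝ, E) ∞ M]

section ModuleStructure

noncomputable instance : Module C^∞⟮𝓘(ℝ, E), M; ℝ⟯ (SmoothVF E M) where
  smul := fsmul
  one_smul X := by ext z; exact one_smul ℝ (X.1 z)
  mul_smul f g X := by ext z; exact mul_smul (f z) (g z) (X.1 z)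
  smul_zero f := by ext z; exact smul_zero (f z)
  smul_add f X Y := by ext z; exact smul_add (f z) (X.1 z) (Y.1 z)
  add_smul f g X := by ext z; exact add_smul (f z) (g z) (X.1 z)
  zero_smul X := by ext z; exact zero_smul ℝ (X.1 z)

instance : IsScalarTower ℝ C^∞⟮𝓘(ℝ, E), M; ℝ⟯ (SmoothVF E M) where
  smul_assoc c f X := by ext z; exact smul_assoc c (f z) (X.1 z)

theorem sum_smul_apply {ι : Type*} [Fintype ι] (f : ι → C^∞⟮𝓘(ℝ, E), M; ℝ⟯)
    (X : ι → SmoothVF E M) (z : M) : (∑ i, f i • X i).1 z = ∑ i, f i z • (X i).1 z := by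
  rw [Submodule.coe_sum, Finset.sum_apply]
  rfl

end ModuleStructure

section ValueAt

variable {S : Submodule ℝ (SmoothVF E M)} {x : M}

/-- The subspace of `T_x M` formed by the values at `x` of the fields in `S`; the terms `Δ_i(x)` of
the weak derived flag are of this form. -/
noncomputable def valueAt (S : Submodule ℝ (SmoothVF E M)) (x : M) :
    Submodule ℝ (TangentSpace 𝓘(ℝ, E) x) :=
  (S.map (SmoothVF E M).subtype).map (LinearMap.proj x)

theorem mem_valueAt {v : TangentSpace 𝓘(ℝ, E) x} : v ∈ valueAt S x ↔ ∃ X ∈ S, X.1 x = v := by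
  constructor
  · rintro ⟨_, ⟨X, hX, rfl⟩, rfl⟩
    exact ⟨X, hX, rfl⟩
  · rintro ⟨X, hX, rfl⟩
    exact ⟨_, ⟨X, hX, rfl⟩, rfl⟩

theorem apply_mem_valueAt {X : SmoothVF E M} (hX : X ∈ S) (x : M) : X.1 x ∈ valueAt S x :=
  mem_valueAt.2 ⟨X, hX, rfl⟩

theorem exists_frame [FiniteDimensional ℝ E] [T2Space M] (hS : ∀ᶠ z in 𝓝 x,
      Module.finrank ℝ (valueAt S z) = Module.finrank ℝ (valueAt S x)) :
    ∃ (n : ℕ) (W : Fin n → SmoothVF E M), (∀ i, W i ∈ S) ∧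
      (LinearIndependent ℝ fun i => (W i).1 x) ∧
      ∀ᶠ z in 𝓝 x, Submodule.span ℝ (Set.range fun i => (W i).1 z) = valueAt S z := by
  have hfin (z : M) : FiniteDimensional ℝ (TangentSpace 𝓘(ℝ, E) z) :=
    inferInstanceAs (FiniteDimensional ℝ E)
  let b := Module.finBasis ℝ (valueAt S x)
  choose W hW hWb using fun i => mem_valueAt.1 (b i).2
  have hli : LinearIndependent ℝ fun i => (W i).1 x := by
    simp only [hWb]
    exact b.linearIndependent.map' (valueAt S x).subtype (Submodule.ker_subtype _)
  refine ⟨_, W, hW, hli, ?_⟩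
  filter_upwards [hS, eventually_linearIndependent_along (g := id) (fun i => (W i).2) hli]
    with z hrank hz
  refine Submodule.eq_of_le_of_finrank_eq (Submodule.span_le.2 ?_) ?_
  · rintro _ ⟨i, rfl⟩
    exact apply_mem_valueAt (hW i) z
  · exact (finrank_span_eq_card hz).trans ((Fintype.card_fin _).trans hrank.symm)

theorem exists_eventually_eq_sum [FiniteDimensional ℝ E] [T2Space M] (hS : ∀ᶠ z in 𝓝 x,
      Module.finrank ℝ (valueAt S z) = Module.finrank ℝ (valueAt S x))
    {Y : SmoothVF E M} (hY : ∀ᶠ z in 𝓝 x, Y.1 z ∈ valueAt S z) :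
    ∃ (n : ℕ) (W : Fin n → SmoothVF E M) (f : Fin n → C^∞⟮𝓘(ℝ, E), M; ℝ⟯), (∀ i, W i ∈ S) ∧
      (LinearIndependent ℝ fun i => (W i).1 x) ∧
      ∀ᶠ z in 𝓝 x, Y.1 z = ∑ i, f i z • (W i).1 z := by
  obtain ⟨n, W, hW, hli, hspan⟩ := exists_frame hS
  obtain ⟨f, hf⟩ := exists_smooth_coeff_along (g := id) (fun i => (W i).2) hli Y.2
  refine ⟨n, W, f, hW, hli, ?_⟩
  filter_upwards [hf, hspan, hY] with z hfz hspanz hYz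
  exact hfz (hspanz ▸ hYz)

theorem exists_smul_eq_self [FiniteDimensional ℝ E] [T2Space M] {Y : SmoothVF E M}
    (hY : ∀ᶠ z in 𝓝 x, Y.1 z = 0) : ∃ φ : C^∞⟮𝓘(ℝ, E), M; ℝ⟯, φ x = 0 ∧ φ • Y = Y := by
  obtain ⟨χ, hχ_one, hχ_supp⟩ := exists_smooth_eventuallyEq_one (E := E) hY
  refine ⟨1 - χ, ?_, ?_⟩
  · change 1 - χ x = 0
    rw [hχ_one.self_of_nhds, Pi.one_apply, sub_self]
  · ext z
    change (1 - χ z) • Y.1 z = Y.1 z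
    by_cases hz : z ∈ tsupport χ
    · rw [show Y.1 z = 0 from hχ_supp hz, smul_zero]
    · rw [image_eq_zero_of_notMem_tsupport hz, sub_zero, one_smul]

end ValueAt

section Germs

variable {S T R : Set (SmoothVF E M)} {x : M}

/-- The fields that near `x` are combinations of fields in `S` with smooth coefficients. Adjoining
the fields that vanish near `x` to the generators makes this depend only on germs at `x`. -/
noncomputable def germSpan (x : M) (S : Set (SmoothVF E M)) :
    Submodule C^∞⟮𝓘(ℝ, E), M; ℝ⟯ (SmoothVF E M) :=
  Submodule.span _ (S ∪ {Y | ∀ᶠ z in 𝓝 x, Y.1 z = 0})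

theorem subset_germSpan (x : M) (S : Set (SmoothVF E M)) : S ⊆ germSpan x S :=
  Set.subset_union_left.trans Submodule.subset_span

theorem germSpan_mono (x : M) (h : S ⊆ T) : germSpan x S ≤ germSpan x T :=
  Submodule.span_mono (Set.union_subset_union_left _ h)

theorem mem_germSpan_of_eventually_eq_zero {Y : SmoothVF E M} (hY : ∀ᶠ z in 𝓝 x, Y.1 z = 0) :
    Y ∈ germSpan x S :=
  Submodule.subset_span (Or.inr hY)

theorem mem_germSpan_of_eventually_eq_sum {ι : Type*} [Fintype ι] {f : ι → C^∞⟮𝓘(ℝ, E), M; ℝ⟯}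
    {W : ι → SmoothVF E M} {Y : SmoothVF E M} (hW : ∀ i, W i ∈ S)
    (h : ∀ᶠ z in 𝓝 x, Y.1 z = ∑ i, f i z • (W i).1 z) : Y ∈ germSpan x S := by
  have hsum : ∑ i, f i • W i ∈ germSpan x S :=
    Submodule.sum_mem _ fun i _ => Submodule.smul_mem _ _ (subset_germSpan x S (hW i))
  have hdiff : Y - ∑ i, f i • W i ∈ germSpan x S := by
    refine mem_germSpan_of_eventually_eq_zero (h.mono fun z hz => ?_)
    change Y.1 z - (∑ i, f i • W i).1 z = 0
    rw [sum_smul_apply, hz, sub_self]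
  simpa using Submodule.add_mem _ hdiff hsum

theorem apply_mem_valueAt_of_mem_germSpan {S : Submodule ℝ (SmoothVF E M)} {A : SmoothVF E M}
    (hA : A ∈ germSpan x S) : A.1 x ∈ valueAt S x := by
  induction hA using Submodule.span_induction with
  | mem A hA =>
    rcases hA with hA | hA
    · exact apply_mem_valueAt hA x
    · rw [hA.self_of_nhds]; exact Submodule.zero_mem _
  | zero => exact Submodule.zero_mem _
  | add A B _ _ hA hB => exact Submodule.add_mem _ hA hB
  | smul f A _ hA => exact Submodule.smul_mem _ (f x) hA

variable [FiniteDimensional ℝ E]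

theorem lie_smul_eq (X Y : SmoothVF E M) (f : C^∞⟮𝓘(ℝ, E), M; ℝ⟯) :
    ⁅X, f • Y⁆ = deriv X f • Y + f • ⁅X, Y⁆ :=
  lie_fsmul X Y f

theorem lie_mem_span (hS : S ⊆ R) (hT : T ⊆ R)
    (hST : ∀ A ∈ S, ∀ B ∈ T, ⁅A, B⁆ ∈ Submodule.span C^∞⟮𝓘(ℝ, E), M; ℝ⟯ R) {A B : SmoothVF E M}
    (hA : A ∈ Submodule.span C^∞⟮𝓘(ℝ, E), M; ℝ⟯ S) (hB : B ∈ Submodule.span C^∞⟮𝓘(ℝ, E), M; ℝ⟯ T) :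
    ⁅A, B⁆ ∈ Submodule.span C^∞⟮𝓘(ℝ, E), M; ℝ⟯ R := by
  induction hA, hB using Submodule.span_induction₂ with
  | mem_mem A B hA hB => exact hST A hA B hB
  | zero_left => simp
  | zero_right => simp
  | add_left _ _ _ _ _ _ h h' => rw [add_lie]; exact Submodule.add_mem _ h h'
  | add_right _ _ _ _ _ _ h h' => rw [lie_add]; exact Submodule.add_mem _ h h'
  | smul_right f _ B _ hB h =>
    rw [lie_smul_eq]
    exact Submodule.add_mem _ (Submodule.smul_mem _ _ (Submodule.span_mono hT hB))
      (Submodule.smul_mem _ _ h)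
  | smul_left f A B hA _ h =>
    rw [← lie_skew, lie_smul_eq]
    refine Submodule.neg_mem _ (Submodule.add_mem _
      (Submodule.smul_mem _ _ (Submodule.span_mono hS hA)) (Submodule.smul_mem _ _ ?_))
    rw [← lie_skew]
    exact Submodule.neg_mem _ h

theorem lie_eventually_eq_zero {A B : SmoothVF E M} (hB : ∀ᶠ z in 𝓝 x, B.1 z = 0) :
    ∀ᶠ z in 𝓝 x, (⁅A, B⁆ : SmoothVF E M).1 z = 0 := by
  filter_upwards [eventually_eventually_nhds.2 hB] with z hz
  have hlie : (⁅A, B⁆ : SmoothVF E M).1 z = (⁅A, 0⁆ : SmoothVF E M).1 z :=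
    EventuallyEq.rfl.mlieBracket_vectorField_eq hz
  rw [hlie, lie_zero]
  rfl

theorem lie_mem_germSpan (hS : S ⊆ R) (hT : T ⊆ R)
    (hST : ∀ A ∈ S, ∀ B ∈ T, ⁅A, B⁆ ∈ R) {A B : SmoothVF E M}
    (hA : A ∈ germSpan x S) (hB : B ∈ germSpan x T) : ⁅A, B⁆ ∈ germSpan x R := by
  refine lie_mem_span (Set.union_subset_union_left _ hS) (Set.union_subset_union_left _ hT) ?_ hA hB
  rintro A (hA | hA) B hB
  · rcases hB with hB | hB
    · exact subset_germSpan x R (hST A hA B hB)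
    · exact mem_germSpan_of_eventually_eq_zero (lie_eventually_eq_zero hB)
  · rw [← lie_skew]
    exact Submodule.neg_mem _ (mem_germSpan_of_eventually_eq_zero (lie_eventually_eq_zero hA))

end Germs

section Derivations

theorem deriv_apply_eq_zero {X : SmoothVF E M} {x : M} (hX : X.1 x = 0)
    (f : C^∞⟮𝓘(ℝ, E), M; ℝ⟯) : deriv X f x = 0 := by
  change mvfderiv 𝓘(ℝ, E) f x (X.1 x) = 0
  rw [hX, map_zero]

variable [FiniteDimensional ℝ E]

/- Expanding both sides of the Jacobi identity for `X`, `Y` and `f • Z` by the Leibniz rule, all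
terms but these cancel. -/
theorem deriv_lie_smul (X Y Z : SmoothVF E M) (f : C^∞⟮𝓘(ℝ, E), M; ℝ⟯) :
    deriv ⁅X, Y⁆ f • Z = (deriv X (deriv Y f) - deriv Y (deriv X f)) • Z := by
  have h := lie_lie X Y (f • Z)
  simp only [lie_smul_eq, lie_add, lie_lie X Y Z, smul_sub] at h
  rw [sub_smul]
  refine sub_eq_zero.1 (Eq.trans ?_ (sub_eq_zero.2 h))
  module

theorem deriv_lie (X Y : SmoothVF E M) (f : C^∞⟮𝓘(ℝ, E), M; ℝ⟯) :
    deriv ⁅X, Y⁆ f = deriv X (deriv Y f) - deriv Y (deriv X f) := by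
  ext x
  have eq_of_apply_ne_zero {Z : SmoothVF E M} (hZ : Z.1 x ≠ 0) :
      deriv ⁅X, Y⁆ f x = (deriv X (deriv Y f) - deriv Y (deriv X f)) x :=
    smul_left_injective ℝ hZ (congrFun (congrArg Subtype.val (deriv_lie_smul X Y Z f)) x)
  by_cases hX : X.1 x = 0
  · by_cases hY : Y.1 x = 0
    · by_cases hXY : (⁅X, Y⁆ : SmoothVF E M).1 x = 0
      · change _ = deriv X (deriv Y f) x - deriv Y (deriv X f) x
        simp only [deriv_apply_eq_zero hX, deriv_apply_eq_zero hY, deriv_apply_eq_zero hXY,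
          sub_zero]
      · exact eq_of_apply_ne_zero hXY
    · exact eq_of_apply_ne_zero hY
  · exact eq_of_apply_ne_zero hX

end Derivations

section Related

variable {E' : Type*} [NormedAddCommGroup E'] [NormedSpace ℝ E']
  {M' : Type*} [TopologicalSpace M'] [ChartedSpace E' M'] [IsManifold 𝓘(ℝ, E') ∞ M']
  {π : M' → M} {X' Y' : SmoothVF E' M'} {X Y : SmoothVF E M}

/-- The vector fields `X'` and `X` are `π`-related: `dπ` maps the values of `X'` to those of `X`. -/
def IsRelated (π : M' → M) (X' : SmoothVF E' M') (X : SmoothVF E M) : Prop :=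
  ∀ y, mfderiv 𝓘(ℝ, E') 𝓘(ℝ, E) π y (X'.1 y) = X.1 (π y)

theorem IsRelated.add (hX : IsRelated π X' X) (hY : IsRelated π Y' Y) :
    IsRelated π (X' + Y') (X + Y) := fun y => by
  change mfderiv 𝓘(ℝ, E') 𝓘(ℝ, E) π y (X'.1 y + Y'.1 y) = X.1 (π y) + Y.1 (π y)
  rw [map_add, hX, hY]

theorem IsRelated.smul (c : ℝ) (hX : IsRelated π X' X) : IsRelated π (c • X') (c • X) := fun y => by
  change mfderiv 𝓘(ℝ, E') 𝓘(ℝ, E) π y (c • X'.1 y) = c • X.1 (π y)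
  rw [map_smul, hX]

theorem isRelated_zero (π : M' → M) : IsRelated π (0 : SmoothVF E' M') (0 : SmoothVF E M) :=
  fun _ => map_zero _

theorem IsRelated.deriv_comp (hπ : ContMDiff 𝓘(ℝ, E') 𝓘(ℝ, E) ∞ π) (hX : IsRelated π X' X)
    (f : C^∞⟮𝓘(ℝ, E), M; ℝ⟯) : deriv X' (f.comp ⟨π, hπ⟩) = (deriv X f).comp ⟨π, hπ⟩ := by
  ext y
  change mvfderiv 𝓘(ℝ, E') (f ∘ π) y (X'.1 y) = mvfderiv 𝓘(ℝ, E) f (π y) (X.1 (π y))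
  rw [mvfderiv_comp_apply y ((f.contMDiff (π y)).mdifferentiableAt (by simp))
    ((hπ y).mdifferentiableAt (by simp)), hX]

theorem IsRelated.lie [FiniteDimensional ℝ E] [FiniteDimensional ℝ E'] [T2Space M]
    (hπ : ContMDiff 𝓘(ℝ, E') 𝓘(ℝ, E) ∞ π) (hX : IsRelated π X' X) (hY : IsRelated π Y' Y) :
    IsRelated π ⁅X', Y'⁆ ⁅X, Y⁆ := by
  intro y
  refine eq_of_forall_mvfderiv_eq fun f => ?_
  calc mvfderiv 𝓘(ℝ, E) f (π y) (mfderiv 𝓘(ℝ, E') 𝓘(ℝ, E) π y ((⁅X', Y'⁆ : SmoothVF E' M').1 y))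
    _ = deriv ⁅X', Y'⁆ (f.comp ⟨π, hπ⟩) y :=
      (mvfderiv_comp_apply y ((f.contMDiff (π y)).mdifferentiableAt (by simp))
        ((hπ y).mdifferentiableAt (by simp)) _).symm
    _ = (deriv X (deriv Y f) - deriv Y (deriv X f)) (π y) := by
      rw [deriv_lie, hX.deriv_comp hπ, hY.deriv_comp hπ, hX.deriv_comp hπ, hY.deriv_comp hπ]
      rfl
    _ = mvfderiv 𝓘(ℝ, E) f (π y) ((⁅X, Y⁆ : SmoothVF E M).1 (π y)) := by
      rw [← deriv_lie]
      rfl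

end Related

end SmoothVF

namespace NegGrading

variable {𝔫 𝔪 : Type*} [LieRing 𝔫] [LieAlgebra ℝ 𝔫] [LieRing 𝔪] [LieAlgebra ℝ 𝔪]
  (H : NegGrading 𝔫) (G : NegGrading 𝔪)

theorem map_proj {p : 𝔫 →ₗ[ℝ] 𝔪} (hp : ∀ i, ∀ X ∈ H.piece i, p X ∈ G.piece i) (i : ℕ) (v : 𝔫) :
    p (H.proj i v) = G.proj i (p v) := by
  induction v using H.piece_induction with
  | zero => simp
  | add a b ha hb => simp only [map_add, ha, hb]
  | mem j v hv =>
    rcases eq_or_ne j i with rfl | hji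
    · rw [H.proj_of_mem hv, G.proj_of_mem (hp j v hv)]
    · rw [H.proj_of_mem_ne hji hv, G.proj_of_mem_ne hji (hp j v hv), map_zero]

theorem mem_piece_of_proj_eq_zero {k : ℕ} {v : 𝔪} (h : ∀ i ≠ k, G.proj i v = 0) :
    v ∈ G.piece k := by
  have hv : v - G.proj k v = 0 := by
    refine G.eq_zero_of_proj fun i => ?_
    rw [map_sub]
    rcases eq_or_ne i k with rfl | hik
    · rw [G.proj_of_mem (G.proj_mem i v), sub_self]
    · rw [h i hik, G.proj_of_mem_ne hik.symm (G.proj_mem k v), sub_zero]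
  rw [sub_eq_zero.1 hv]
  exact G.proj_mem k v

theorem eq_zero_of_mem_piece {i j : ℕ} (hij : i ≠ j) {v : 𝔪} (hi : v ∈ G.piece i)
    (hj : v ∈ G.piece j) : v = 0 := by
  rw [← G.proj_of_mem hj, G.proj_of_mem_ne hij hi]

theorem lieIdeal_le_center {I : LieIdeal ℝ 𝔪} {k : ℕ} (hI : ∀ X ∈ I, X ∈ G.piece k) :
    I ≤ LieAlgebra.center ℝ 𝔪 := by
  intro X hX
  rw [LieAlgebra.center, LieModule.mem_maxTrivSubmodule]
  intro Y
  induction Y using G.piece_induction with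
  | zero => exact zero_lie X
  | add a b ha hb => rw [add_lie, ha, hb, add_zero]
  | mem i Y hY =>
    rcases i with _ | i
    · rw [G.piece_zero, Submodule.mem_bot] at hY
      rw [hY, zero_lie]
    · exact G.eq_zero_of_mem_piece (by omega) (G.lie_mem hY (hI X hX))
        (hI _ (lie_mem_right ℝ 𝔪 I Y X hX))

end NegGrading

namespace TangentDistribution

open SmoothVF

variable {E : Type*} [NormedAddCommGroup E] [NormedSpace ℝ E]
  {M : Type*} [TopologicalSpace M] [ChartedSpace E M] [IsManifold 𝓘(ℝ, E) ∞ M]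
  (Δ : TangentDistribution E M)

theorem valueAt_sections (x : M) : valueAt Δ.sections x = Δ.space x := by
  ext v
  rw [mem_valueAt]
  constructor
  · rintro ⟨X, hX, rfl⟩
    exact hX x
  · exact fun hv => Δ.exists_section x v hv

variable [FiniteDimensional ℝ E]

section Flag

theorem apply_mem_flag {i : ℕ} {X : SmoothVF E M} (hX : X ∈ Δ.flagSections i) (x : M) :
    X.1 x ∈ Δ.flag i x :=
  apply_mem_valueAt hX x

theorem flag_mono {i j : ℕ} (h : i ≤ j) (x : M) : Δ.flag i x ≤ Δ.flag j x :=
  Submodule.map_mono (Submodule.map_mono (Δ.flagSections_mono h))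

theorem smul_mem_fiberKer {x : M} {i : ℕ} {f : C^∞⟮𝓘(ℝ, E), M; ℝ⟯} {X : SmoothVF E M}
    (hf : f x = 0) (hX : X ∈ Δ.flagSections i) : f • X ∈ Δ.fiberKer x i :=
  Submodule.mem_sup_right (Submodule.subset_span ⟨f, hf, X, hX, rfl⟩)

theorem apply_mem_flag_of_mem_fiberKer {x : M} {i : ℕ} {X : SmoothVF E M}
    (hX : X ∈ Δ.fiberKer x i) : X.1 x ∈ Δ.flag (i - 1) x := by
  let eval : SmoothVF E M →ₗ[ℝ] TangentSpace 𝓘(ℝ, E) x :=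
    LinearMap.proj x ∘ₗ (SmoothVF E M).subtype
  have hle : Δ.fiberKer x i ≤ (Δ.flag (i - 1) x).comap eval := by
    refine sup_le (fun Y hY => Δ.apply_mem_flag hY x) (Submodule.span_le.2 ?_)
    rintro _ ⟨f, hf, Y, -, rfl⟩
    change f x • Y.1 x ∈ Δ.flag (i - 1) x
    rw [hf, zero_smul]
    exact Submodule.zero_mem _
  exact hle hX

/-- The evaluation `Γ(Δ_i) → Δ_i(x)` of fields at a point. -/
noncomputable def flagEval (x : M) (i : ℕ) : Δ.flagSections i →ₗ[ℝ] Δ.flag i x where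
  toFun X := ⟨X.1.1 x, Δ.apply_mem_flag X.2 x⟩
  map_add' _ _ := rfl
  map_smul' _ _ := rfl

theorem flagEval_surjective (x : M) (i : ℕ) : Function.Surjective (Δ.flagEval x i) := by
  rintro ⟨v, hv⟩
  obtain ⟨X, hX, rfl⟩ := mem_valueAt.1 hv
  exact ⟨⟨X, hX⟩, rfl⟩

end Flag

section LocalGenerators

variable [T2Space M] {Δ} {R : ℕ → Submodule ℝ (SmoothVF E M)}

theorem flagSections_le_germSpan (hmono : Monotone R) (hone : ∀ z, valueAt (R 1) z = Δ.space z)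
    (hlie : ∀ i, ∀ A ∈ R 1, ∀ B ∈ R i, ⁅A, B⁆ ∈ R (i + 1)) (x : M) (i : ℕ) :
    Δ.flagSections i ≤ (germSpan x (R i : Set (SmoothVF E M))).restrictScalars ℝ := by
  have hsections : Δ.sections ≤ (germSpan x (R 1 : Set (SmoothVF E M))).restrictScalars ℝ := by
    intro Y hY
    obtain ⟨n, W, f, hW, -, hf⟩ := exists_eventually_eq_sum (S := R 1) (x := x) (Y := Y)
      (.of_forall fun z => by rw [hone, hone]; exact Δ.finrank_eq z x)
      (.of_forall fun z => by rw [hone]; exact hY z)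
    exact mem_germSpan_of_eventually_eq_sum hW hf
  induction i with
  | zero => exact bot_le
  | succ i ih =>
    rcases i with _ | i
    · exact hsections
    · refine sup_le (ih.trans (germSpan_mono x (hmono (Nat.le_succ _)))) (Submodule.span_le.2 ?_)
      rintro _ ⟨A, hA, B, hB, rfl⟩
      exact lie_mem_germSpan (hmono (by omega)) (hmono (by omega)) (hlie (i + 1)) (hsections hA)
        (ih hB)

theorem flag_le_valueAt (hmono : Monotone R) (hone : ∀ z, valueAt (R 1) z = Δ.space z)
    (hlie : ∀ i, ∀ A ∈ R 1, ∀ B ∈ R i, ⁅A, B⁆ ∈ R (i + 1)) (i : ℕ) (x : M) :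
    Δ.flag i x ≤ valueAt (R i) x := by
  intro v hv
  obtain ⟨X, hX, rfl⟩ := mem_valueAt.1 hv
  exact apply_mem_valueAt_of_mem_germSpan (flagSections_le_germSpan hmono hone hlie x i hX)

end LocalGenerators

section Regular

/-- The terms of the weak derived flag of `Δ` have constant rank in a neighbourhood of `x`. -/
def IsRegularAt (x : M) : Prop :=
  ∀ i, ∀ᶠ z in 𝓝 x, Module.finrank ℝ (Δ.flag i z) = Module.finrank ℝ (Δ.flag i x)

variable {Δ}

theorem IsRegular.isRegularAt (hΔ : Δ.IsRegular) (x : M) : Δ.IsRegularAt x :=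
  fun i => .of_forall fun z => hΔ i z x

variable [T2Space M] {x : M}

theorem IsRegularAt.mem_fiberKer_of_apply_eq_zero (hΔ : Δ.IsRegularAt x) {i : ℕ}
    {Z : SmoothVF E M} (hZ : Z ∈ Δ.flagSections i) (hZx : Z.1 x = 0) : Z ∈ Δ.fiberKer x i := by
  obtain ⟨n, W, f, hW, hli, hf⟩ := exists_eventually_eq_sum (hΔ i)
    (.of_forall fun z => apply_mem_valueAt hZ z)
  have hfx : ∀ j, f j x = 0 :=
    Fintype.linearIndependent_iff.1 hli (fun j => f j x) (hf.self_of_nhds.symm.trans hZx)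
  have hsum : ∑ j, f j • W j ∈ Δ.flagSections i :=
    Submodule.sum_mem _ fun j _ => Δ.fsmul_mem i _ (hW j)
  obtain ⟨φ, hφx, hφ⟩ : ∃ φ : C^∞⟮𝓘(ℝ, E), M; ℝ⟯, φ x = 0 ∧
      φ • (Z - ∑ j, f j • W j) = Z - ∑ j, f j • W j := by
    refine exists_smul_eq_self (hf.mono fun z hz => ?_)
    change Z.1 z - (∑ j, f j • W j).1 z = 0
    rw [sum_smul_apply, hz, sub_self]
  rw [← sub_add_cancel Z (∑ j, f j • W j), ← hφ]
  exact Submodule.add_mem _ (Δ.smul_mem_fiberKer hφx (Submodule.sub_mem _ hZ hsum))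
    (Submodule.sum_mem _ fun j _ => Δ.smul_mem_fiberKer (hfx j) (hW j))

theorem IsRegularAt.mem_fiberKer_iff (hΔ : Δ.IsRegularAt x) {i : ℕ} {X : SmoothVF E M}
    (hX : X ∈ Δ.flagSections i) : X ∈ Δ.fiberKer x i ↔ X.1 x ∈ Δ.flag (i - 1) x := by
  refine ⟨Δ.apply_mem_flag_of_mem_fiberKer, fun h => ?_⟩
  obtain ⟨Y, hY, hYX⟩ := mem_valueAt.1 h
  have hdiff : X - Y ∈ Δ.fiberKer x i :=
    hΔ.mem_fiberKer_of_apply_eq_zero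
      (Submodule.sub_mem _ hX (Δ.flagSections_mono (Nat.sub_le i 1) hY))
      (sub_eq_zero.2 hYX.symm)
  rw [← sub_add_cancel X Y]
  exact Submodule.add_mem _ hdiff (Submodule.mem_sup_left hY)

theorem IsRegularAt.cls_eq_zero_iff (hΔ : Δ.IsRegularAt x) {i : ℕ} {X : Δ.flagSections i} :
    Δ.cls x i X = 0 ↔ X.1.1 x ∈ Δ.flag (i - 1) x := by
  rw [← hΔ.mem_fiberKer_iff X.2]
  refine ⟨fun h => ?_, Δ.cls_eq_zero x⟩
  have hmk := Δ.carnotComponent_cls x i X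
  rw [h, map_zero] at hmk
  exact (Submodule.Quotient.mk_eq_zero ((Δ.fiberKer x i).submoduleOf _)).1 hmk.symm

theorem IsRegularAt.ker_flagEval_le (hΔ : Δ.IsRegularAt x) (i : ℕ) :
    LinearMap.ker (Δ.flagEval x i) ≤ LinearMap.ker (Δ.cls x i) := by
  intro X hX
  refine hΔ.cls_eq_zero_iff.2 ?_
  rw [show X.1.1 x = 0 from congrArg Subtype.val (LinearMap.mem_ker.1 hX)]
  exact Submodule.zero_mem _

/-- The map `Δ_i(x) → g_{-i}(x)` that identifies `g_{-i}(x)` with `Δ_i(x) / Δ_{i-1}(x)` at a regular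
point, as a map into the Carnot algebra. -/
noncomputable def IsRegularAt.valueCls (hΔ : Δ.IsRegularAt x) (i : ℕ) :
    Δ.flag i x →ₗ[ℝ] Δ.Carnot x :=
  (LinearMap.ker (Δ.flagEval x i)).liftQ (Δ.cls x i) (hΔ.ker_flagEval_le i) ∘ₗ
    ((Δ.flagEval x i).quotKerEquivOfSurjective (Δ.flagEval_surjective x i)).symm.toLinearMap

theorem IsRegularAt.valueCls_flagEval (hΔ : Δ.IsRegularAt x) {i : ℕ} (X : Δ.flagSections i) :
    hΔ.valueCls i (Δ.flagEval x i X) = Δ.cls x i X := by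
  have hX : ((Δ.flagEval x i).quotKerEquivOfSurjective (Δ.flagEval_surjective x i)).symm
      (Δ.flagEval x i X) = Submodule.Quotient.mk X :=
    (LinearEquiv.symm_apply_eq _).2 rfl
  exact congrArg ((LinearMap.ker (Δ.flagEval x i)).liftQ (Δ.cls x i) (hΔ.ker_flagEval_le i)) hX

theorem IsRegularAt.valueCls_eq_zero_iff (hΔ : Δ.IsRegularAt x) {i : ℕ} {v : Δ.flag i x} :
    hΔ.valueCls i v = 0 ↔ v.1 ∈ Δ.flag (i - 1) x := by
  obtain ⟨X, rfl⟩ := Δ.flagEval_surjective x i v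
  rw [hΔ.valueCls_flagEval, hΔ.cls_eq_zero_iff]
  rfl

end Regular

end TangentDistribution

namespace TangentDistribution

variable {E : Type*} [NormedAddCommGroup E] [NormedSpace ℝ E] [FiniteDimensional ℝ E]
  {M : Type*} [TopologicalSpace M] [ChartedSpace E M] [IsManifold 𝓘(ℝ, E) ∞ M]
  (Δ : TangentDistribution E M) {V : Type*} [AddCommGroup V] [Module ℝ V]

/-- The linear map out of the Carnot algebra at `x` given by linear maps out of the modules
`Γ(Δ_i)` that annihilate the fields whose class at `x` vanishes. -/
noncomputable def carnotLift (x : M) (ψ : ∀ i, Δ.flagSections i →ₗ[ℝ] V)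
    (hψ : ∀ i, ∀ X : Δ.flagSections i, X.1 ∈ Δ.fiberKer x i → ψ i X = 0) : Δ.Carnot x →ₗ[ℝ] V :=
  DirectSum.toModule ℝ ℕ V fun i =>
    ((Δ.fiberKer x i).submoduleOf (Δ.flagSections i)).liftQ (ψ i) (hψ i)

theorem carnotLift_cls (x : M) {ψ : ∀ i, Δ.flagSections i →ₗ[ℝ] V}
    (hψ : ∀ i, ∀ X : Δ.flagSections i, X.1 ∈ Δ.fiberKer x i → ψ i X = 0) (i : ℕ)
    (X : Δ.flagSections i) : Δ.carnotLift x ψ hψ (Δ.cls x i X) = ψ i X :=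
  DirectSum.toModule_lof ℝ i (Δ.pieceMk x i X)

end TangentDistribution

/-- `π : (M', Δ') → (M, Δ)` is a smooth map whose differential restricts to isomorphisms
`Δ'(x) → Δ(π x)`: the part of the notion of an integrable extension which suffices for a map between
the Carnot algebras. -/
structure IsFiberwiseIso
    {E' : Type*} [NormedAddCommGroup E'] [NormedSpace ℝ E']
    {M' : Type*} [TopologicalSpace M'] [ChartedSpace E' M'] [IsManifold 𝓘(ℝ, E') ∞ M']
    {E : Type*} [NormedAddCommGroup E] [NormedSpace ℝ E]
    {M : Type*} [TopologicalSpace M] [ChartedSpace E M] [IsManifold 𝓘(ℝ, E) ∞ M]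
    (Δ' : TangentDistribution E' M') (Δ : TangentDistribution E M) (π : M' → M) : Prop where
  contMDiff : ContMDiff 𝓘(ℝ, E') 𝓘(ℝ, E) ∞ π
  bijOn : ∀ x, Set.BijOn (mfderiv 𝓘(ℝ, E') 𝓘(ℝ, E) π x) (Δ'.space x) (Δ.space (π x))

namespace IsFiberwiseIso

open SmoothVF TangentDistribution

variable {E' : Type*} [NormedAddCommGroup E'] [NormedSpace ℝ E'] [FiniteDimensional ℝ E']
  {M' : Type*} [TopologicalSpace M'] [ChartedSpace E' M'] [IsManifold 𝓘(ℝ, E') ∞ M']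
  {E : Type*} [NormedAddCommGroup E] [NormedSpace ℝ E]
  {M : Type*} [TopologicalSpace M] [ChartedSpace E M] [IsManifold 𝓘(ℝ, E) ∞ M]
  {Δ' : TangentDistribution E' M'} {Δ : TangentDistribution E M} {π : M' → M}

theorem _root_.IsIntegrableExtension.isFiberwiseIso (hπ : IsIntegrableExtension Δ' Δ π) :
    IsFiberwiseIso Δ' Δ π :=
  ⟨hπ.contMDiff, hπ.bijOn⟩

variable [FiniteDimensional ℝ E]

section Lift

variable [T2Space M'] [T2Space M]

theorem contMDiff_lift (hπ : IsFiberwiseIso Δ' Δ π) {X : SmoothVF E M}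
    {Y : ∀ y, TangentSpace 𝓘(ℝ, E') y} (hY : ∀ y, Y y ∈ Δ'.space y)
    (hYX : ∀ y, mfderiv 𝓘(ℝ, E') 𝓘(ℝ, E) π y (Y y) = X.1 (π y)) :
    ContMDiff 𝓘(ℝ, E') 𝓘(ℝ, E').tangent ∞
      fun y => (⟨y, Y y⟩ : TangentBundle 𝓘(ℝ, E') M') := by
  intro y
  let D z : TangentSpace 𝓘(ℝ, E') z →ₗ[ℝ] TangentSpace 𝓘(ℝ, E) (π z) :=
    (mfderiv 𝓘(ℝ, E') 𝓘(ℝ, E) π z).toLinearMap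
  have hD_sum z {n : ℕ} (c : Fin n → ℝ) (w : Fin n → TangentSpace 𝓘(ℝ, E') z) :
      D z (∑ i, c i • w i) = ∑ i, c i • D z (w i) := by
    simp only [map_sum, map_smul]
  obtain ⟨n, W, hW, hli, hspan⟩ := exists_frame (S := Δ'.sections) (x := y) <|
    .of_forall fun z => by
      rw [Δ'.valueAt_sections, Δ'.valueAt_sections]; exact Δ'.finrank_eq z y
  have hsum_mem z (c : Fin n → ℝ) : ∑ i, c i • (W i).1 z ∈ Δ'.space z :=
    Submodule.sum_mem _ fun i _ => Submodule.smul_mem _ _ (hW i z)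
  have hDli : LinearIndependent ℝ fun i => D y ((W i).1 y) := by
    refine Fintype.linearIndependent_iff.2 fun c hc => Fintype.linearIndependent_iff.1 hli c <|
      (hπ.bijOn y).injOn (hsum_mem y c) (Δ'.space y).zero_mem ?_
    exact ((hD_sum y c _).trans hc).trans (map_zero (D y)).symm
  have hDW i : ContMDiff 𝓘(ℝ, E') 𝓘(ℝ, E).tangent ∞
      fun z => (⟨π z, D z ((W i).1 z)⟩ : TangentBundle 𝓘(ℝ, E) M) :=
    (hπ.contMDiff.contMDiff_tangentMap (by simp)).comp (W i).2
  obtain ⟨f, hf⟩ := exists_smooth_coeff_along hDW hDli (X.2.comp hπ.contMDiff)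
  refine (SmoothVF.contMDiff (∑ i, f i • W i) y).congr_of_eventuallyEq ?_
  filter_upwards [hf, hspan] with z hfz hspanz
  have hYspan : Y z ∈ Submodule.span ℝ (Set.range fun i => (W i).1 z) := by
    rw [hspanz, Δ'.valueAt_sections]; exact hY z
  obtain ⟨c, hc⟩ := (Submodule.mem_span_range_iff_exists_fun ℝ).1 hYspan
  have hDY : D z (Y z) = ∑ i, f i z • D z ((W i).1 z) :=
    (hYX z).trans (hfz ((Submodule.mem_span_range_iff_exists_fun ℝ).2
      ⟨c, by rw [← hD_sum, hc]; exact hYX z⟩))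
  rw [(hπ.bijOn z).injOn (hY z) (hsum_mem z _) (hDY.trans (hD_sum z _ _).symm), ← sum_smul_apply]

theorem exists_isRelated_section (hπ : IsFiberwiseIso Δ' Δ π) {X : SmoothVF E M}
    (hX : X ∈ Δ.sections) : ∃ X' ∈ Δ'.sections, IsRelated π X' X := by
  choose Y hY hYX using fun y => (hπ.bijOn y).surjOn (hX (π y))
  exact ⟨⟨Y, hπ.contMDiff_lift hY hYX⟩, hY, hYX⟩

theorem exists_isRelated_flagSection (hπ : IsFiberwiseIso Δ' Δ π) {i : ℕ} {X : SmoothVF E M}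
    (hX : X ∈ Δ.flagSections i) : ∃ X' ∈ Δ'.flagSections i, IsRelated π X' X := by
  induction i generalizing X with
  | zero =>
    rw [(Submodule.mem_bot ℝ).1 hX]
    exact ⟨0, Submodule.zero_mem _, isRelated_zero π⟩
  | succ i ih =>
    rcases i with _ | i
    · exact hπ.exists_isRelated_section hX
    · let S : Submodule ℝ (SmoothVF E M) :=
        { carrier := {X | ∃ X' ∈ Δ'.flagSections (i + 2), IsRelated π X' X}
          add_mem' := fun ⟨X', hX', hX⟩ ⟨Y', hY', hY⟩ =>
            ⟨X' + Y', Submodule.add_mem _ hX' hY', hX.add hY⟩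
          zero_mem' := ⟨0, Submodule.zero_mem _, isRelated_zero π⟩
          smul_mem' := fun c _ ⟨X', hX', hX⟩ =>
            ⟨c • X', Submodule.smul_mem _ c hX', hX.smul c⟩ }
      refine (sup_le (c := S) (fun A hA => ?_) (Submodule.span_le.2 ?_)) hX
      · obtain ⟨A', hA', hAA'⟩ := ih hA
        exact ⟨A', Δ'.flagSections_le_succ _ hA', hAA'⟩
      · rintro _ ⟨A, hA, B, hB, rfl⟩
        obtain ⟨A', hA', hAA'⟩ := hπ.exists_isRelated_section hA
        obtain ⟨B', hB', hBB'⟩ := ih hB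
        exact ⟨⁅A', B'⁆, Δ'.lie_sections_mem hA' hB', hAA'.lie hπ.contMDiff hBB'⟩

end Lift

section Flag

variable (Δ' Δ π) in
/-- The sections of `Δ'_i` which are `π`-related to a section of `Δ_i`. -/
noncomputable def relatedSections (i : ℕ) : Submodule ℝ (SmoothVF E' M') where
  carrier := {X' | X' ∈ Δ'.flagSections i ∧ ∃ X ∈ Δ.flagSections i, IsRelated π X' X}
  add_mem' := fun ⟨hX', X, hX, hXX'⟩ ⟨hY', Y, hY, hYY'⟩ =>
    ⟨Submodule.add_mem _ hX' hY', X + Y, Submodule.add_mem _ hX hY, hXX'.add hYY'⟩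
  zero_mem' := ⟨Submodule.zero_mem _, 0, Submodule.zero_mem _, isRelated_zero π⟩
  smul_mem' := fun c _ ⟨hX', X, hX, hXX'⟩ =>
    ⟨Submodule.smul_mem _ c hX', c • X, Submodule.smul_mem _ c hX, hXX'.smul c⟩

theorem monotone_relatedSections : Monotone (relatedSections Δ' Δ π) :=
  fun _ _ hij _ ⟨hX', X, hX, hXX'⟩ =>
    ⟨Δ'.flagSections_mono hij hX', X, Δ.flagSections_mono hij hX, hXX'⟩

variable [T2Space M]

theorem lie_mem_relatedSections (hπ : IsFiberwiseIso Δ' Δ π) {i : ℕ} {A B : SmoothVF E' M'}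
    (hA : A ∈ relatedSections Δ' Δ π 1) (hB : B ∈ relatedSections Δ' Δ π i) :
    ⁅A, B⁆ ∈ relatedSections Δ' Δ π (i + 1) := by
  obtain ⟨hA', X, hX, hAX⟩ := hA
  obtain ⟨hB', Y, hY, hBY⟩ := hB
  exact ⟨Δ'.lie_sections_mem hA' hB', ⁅X, Y⁆, Δ.lie_sections_mem hX hY,
    hAX.lie hπ.contMDiff hBY⟩

variable [T2Space M']

theorem valueAt_relatedSections_one (hπ : IsFiberwiseIso Δ' Δ π) (x : M') :
    valueAt (relatedSections Δ' Δ π 1) x = Δ'.space x := by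
  ext v
  rw [mem_valueAt]
  constructor
  · rintro ⟨X', hX', rfl⟩
    exact hX'.1 x
  · intro hv
    obtain ⟨X, hX, hXv⟩ := Δ.exists_section (π x) _ ((hπ.bijOn x).mapsTo hv)
    obtain ⟨X', hX', hXX'⟩ := hπ.exists_isRelated_section hX
    exact ⟨X', ⟨hX', X, hX, hXX'⟩, (hπ.bijOn x).injOn (hX' x) hv ((hXX' x).trans hXv)⟩

theorem flag_le_valueAt_relatedSections (hπ : IsFiberwiseIso Δ' Δ π) (i : ℕ) (x : M') :
    Δ'.flag i x ≤ valueAt (relatedSections Δ' Δ π i) x :=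
  flag_le_valueAt monotone_relatedSections hπ.valueAt_relatedSections_one
    (fun _ _ hA _ hB => hπ.lie_mem_relatedSections hA hB) i x

theorem map_flag (hπ : IsFiberwiseIso Δ' Δ π) (i : ℕ) (x : M') :
    (Δ'.flag i x).map (mfderiv 𝓘(ℝ, E') 𝓘(ℝ, E) π x).toLinearMap = Δ.flag i (π x) := by
  apply le_antisymm
  · rintro _ ⟨v, hv, rfl⟩
    obtain ⟨X', ⟨-, X, hX, hXX'⟩, rfl⟩ :=
      mem_valueAt.1 (hπ.flag_le_valueAt_relatedSections i x hv)
    exact mem_valueAt.2 ⟨X, hX, (hXX' x).symm⟩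
  · intro v hv
    obtain ⟨X, hX, rfl⟩ := mem_valueAt.1 hv
    obtain ⟨X', hX', hXX'⟩ := hπ.exists_isRelated_flagSection hX
    exact ⟨X'.1 x, Δ'.apply_mem_flag hX' x, hXX' x⟩

theorem mfderiv_mem_flag (hπ : IsFiberwiseIso Δ' Δ π) {i : ℕ} {x : M'}
    {v : TangentSpace 𝓘(ℝ, E') x} (hv : v ∈ Δ'.flag i x) :
    mfderiv 𝓘(ℝ, E') 𝓘(ℝ, E) π x v ∈ Δ.flag i (π x) := by
  rw [← hπ.map_flag]
  exact Submodule.mem_map_of_mem (f := (mfderiv 𝓘(ℝ, E') 𝓘(ℝ, E) π x).toLinearMap) hv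

/-- The restriction `Δ'_i(x) → Δ_i(π x)` of the differential of `π`. -/
noncomputable def flagMap (hπ : IsFiberwiseIso Δ' Δ π) (i : ℕ) (x : M') :
    Δ'.flag i x →ₗ[ℝ] Δ.flag i (π x) :=
  (mfderiv 𝓘(ℝ, E') 𝓘(ℝ, E) π x).toLinearMap.restrict fun _ hv => hπ.mfderiv_mem_flag hv

end Flag

section CarnotHom

variable [T2Space M'] [T2Space M] {x : M'}

/-- The linear map between the Carnot algebras at `x` and `π x` induced by the differential of `π`
at `x`. -/
noncomputable def carnotMap (hπ : IsFiberwiseIso Δ' Δ π) (hΔ : Δ.IsRegularAt (π x)) :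
    Δ'.Carnot x →ₗ[ℝ] Δ.Carnot (π x) :=
  Δ'.carnotLift x (fun i => hΔ.valueCls i ∘ₗ hπ.flagMap i x ∘ₗ Δ'.flagEval x i) fun _ _ hX' =>
    hΔ.valueCls_eq_zero_iff.2 (hπ.mfderiv_mem_flag (Δ'.apply_mem_flag_of_mem_fiberKer hX'))

theorem carnotMap_cls (hπ : IsFiberwiseIso Δ' Δ π) (hΔ : Δ.IsRegularAt (π x)) {i : ℕ}
    (X' : Δ'.flagSections i) : hπ.carnotMap hΔ (Δ'.cls x i X') =
      hΔ.valueCls i (hπ.flagMap i x (Δ'.flagEval x i X')) :=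
  Δ'.carnotLift_cls x _ i X'

theorem carnotMap_cls_eq (hπ : IsFiberwiseIso Δ' Δ π) (hΔ : Δ.IsRegularAt (π x)) {i : ℕ}
    {X' : Δ'.flagSections i} {X : Δ.flagSections i}
    (hXX' : mfderiv 𝓘(ℝ, E') 𝓘(ℝ, E) π x (X'.1.1 x) = X.1.1 (π x)) :
    hπ.carnotMap hΔ (Δ'.cls x i X') = Δ.cls (π x) i X := by
  rw [hπ.carnotMap_cls, ← hΔ.valueCls_flagEval X]
  exact congrArg (hΔ.valueCls i) (Subtype.ext hXX')

theorem exists_isRelated_cls_eq (hπ : IsFiberwiseIso Δ' Δ π) (hΔ' : Δ'.IsRegularAt x) {i : ℕ}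
    (X' : Δ'.flagSections i) : ∃ (A : Δ'.flagSections i) (X : Δ.flagSections i),
      IsRelated π A.1 X.1 ∧ Δ'.cls x i A = Δ'.cls x i X' := by
  obtain ⟨A, ⟨hA, X, hX, hAX⟩, hAX'⟩ :=
    mem_valueAt.1 (hπ.flag_le_valueAt_relatedSections i x (Δ'.apply_mem_flag X'.2 x))
  refine ⟨⟨A, hA⟩, ⟨X, hX⟩, hAX, ?_⟩
  rw [← hΔ'.valueCls_flagEval, ← hΔ'.valueCls_flagEval]
  exact congrArg (hΔ'.valueCls i) (Subtype.ext hAX')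

theorem carnotMap_lie (hπ : IsFiberwiseIso Δ' Δ π) (hΔ : Δ.IsRegularAt (π x))
    (hΔ' : Δ'.IsRegularAt x) (a b : Δ'.Carnot x) :
    hπ.carnotMap hΔ ⁅a, b⁆ = ⁅hπ.carnotMap hΔ a, hπ.carnotMap hΔ b⁆ := by
  induction a using Δ'.carnot_induction x with
  | zero => simp only [zero_lie, map_zero]
  | add a a' ha ha' => simp only [add_lie, map_add, ha, ha']
  | cls i X' =>
  induction b using Δ'.carnot_induction x with
  | zero => simp only [lie_zero, map_zero]
  | add b b' hb hb' => simp only [lie_add, map_add, hb, hb']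
  | cls j Y' =>
  obtain ⟨A, X, hAX, hAX'⟩ := hπ.exists_isRelated_cls_eq hΔ' X'
  obtain ⟨B, Y, hBY, hBY'⟩ := hπ.exists_isRelated_cls_eq hΔ' Y'
  rw [← hAX', ← hBY', hπ.carnotMap_cls_eq hΔ (hAX x), hπ.carnotMap_cls_eq hΔ (hBY x),
    Δ'.lie_cls, Δ.lie_cls]
  exact hπ.carnotMap_cls_eq hΔ (hAX.lie hπ.contMDiff hBY x)

/-- The homomorphism between the Carnot algebras at `x` and `π x` induced by the differential of `π`
at `x`. -/
noncomputable def carnotHom (hπ : IsFiberwiseIso Δ' Δ π) (hΔ : Δ.IsRegularAt (π x))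
    (hΔ' : Δ'.IsRegularAt x) : Δ'.Carnot x →ₗ⁅ℝ⁆ Δ.Carnot (π x) :=
  { hπ.carnotMap hΔ with map_lie' := fun {a b} => hπ.carnotMap_lie hΔ hΔ' a b }

variable (hπ : IsFiberwiseIso Δ' Δ π) (hΔ : Δ.IsRegularAt (π x)) (hΔ' : Δ'.IsRegularAt x)

theorem carnotHom_cls_eq {i : ℕ} {X' : Δ'.flagSections i} {X : Δ.flagSections i}
    (hXX' : mfderiv 𝓘(ℝ, E') 𝓘(ℝ, E) π x (X'.1.1 x) = X.1.1 (π x)) :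
    hπ.carnotHom hΔ hΔ' (Δ'.cls x i X') = Δ.cls (π x) i X :=
  hπ.carnotMap_cls_eq hΔ hXX'

theorem carnotHom_valueCls {i : ℕ} (v : Δ'.flag i x) :
    hπ.carnotHom hΔ hΔ' (hΔ'.valueCls i v) = hΔ.valueCls i (hπ.flagMap i x v) := by
  obtain ⟨X', rfl⟩ := Δ'.flagEval_surjective x i v
  rw [hΔ'.valueCls_flagEval]
  exact hπ.carnotMap_cls hΔ X'

theorem carnotHom_mem_piece {i : ℕ} {a : Δ'.Carnot x} (ha : a ∈ (Δ'.carnotGrading x).piece i) :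
    hπ.carnotHom hΔ hΔ' a ∈ (Δ.carnotGrading (π x)).piece i := by
  obtain ⟨X', rfl⟩ := ha
  obtain ⟨X, hX⟩ := Δ.flagEval_surjective (π x) i (hπ.flagMap i x (Δ'.flagEval x i X'))
  exact ⟨X, (hπ.carnotHom_cls_eq hΔ hΔ' (congrArg Subtype.val hX).symm).symm⟩

theorem carnotHom_surjective : Function.Surjective (hπ.carnotHom hΔ hΔ') := by
  intro b
  induction b using Δ.carnot_induction (π x) with
  | zero => exact ⟨0, map_zero _⟩
  | add b b' hb hb' =>
    obtain ⟨a, rfl⟩ := hb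
    obtain ⟨a', rfl⟩ := hb'
    exact ⟨a + a', map_add _ a a'⟩
  | cls i X =>
    obtain ⟨X', hX', hXX'⟩ := hπ.exists_isRelated_flagSection X.2
    exact ⟨Δ'.cls x i ⟨X', hX'⟩, hπ.carnotHom_cls_eq hΔ hΔ' (hXX' x)⟩

theorem carnotHom_valueCls_eq_zero_iff {i : ℕ} {v : Δ'.flag i x} :
    hπ.carnotHom hΔ hΔ' (hΔ'.valueCls i v) = 0 ↔
      ∃ u ∈ Δ'.flag (i - 1) x,
        v.1 - u ∈ LinearMap.ker (mfderiv 𝓘(ℝ, E') 𝓘(ℝ, E) π x).toLinearMap := by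
  rw [hπ.carnotHom_valueCls, hΔ.valueCls_eq_zero_iff, ← hπ.map_flag]
  refine exists_congr fun u => and_congr_right fun _ => ?_
  rw [LinearMap.mem_ker, map_sub, sub_eq_zero]
  exact eq_comm

end CarnotHom

section PureGrading

variable [T2Space M'] [T2Space M] {x : M'} {k : ℕ}
  (hπ : IsFiberwiseIso Δ' Δ π) (hΔ : Δ.IsRegularAt (π x)) (hΔ' : Δ'.IsRegularAt x)
  (hle : LinearMap.ker (mfderiv 𝓘(ℝ, E') 𝓘(ℝ, E) π x).toLinearMap ≤ Δ'.flag k x)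
  (hdis : Disjoint (LinearMap.ker (mfderiv 𝓘(ℝ, E') 𝓘(ℝ, E) π x).toLinearMap)
    (Δ'.flag (k - 1) x))

include hle hdis in
theorem valueCls_eq_zero_of_carnotHom_eq_zero {i : ℕ} (hik : i ≠ k) {v : Δ'.flag i x}
    (hv : hπ.carnotHom hΔ hΔ' (hΔ'.valueCls i v) = 0) : hΔ'.valueCls i v = 0 := by
  obtain ⟨u, hu, hvu⟩ := (hπ.carnotHom_valueCls_eq_zero_iff hΔ hΔ').1 hv
  rw [hΔ'.valueCls_eq_zero_iff]
  rcases lt_or_gt_of_ne hik with hlt | hgt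
  · have hvu' : v.1 - u ∈ Δ'.flag (k - 1) x :=
      Δ'.flag_mono (by omega) x (Submodule.sub_mem _ v.2 (Δ'.flag_mono (Nat.sub_le i 1) x hu))
    rwa [sub_eq_zero.1 (Submodule.disjoint_def.1 hdis _ hvu hvu')]
  · rw [← sub_add_cancel v.1 u]
    exact Submodule.add_mem _ (Δ'.flag_mono (by omega) x (hle hvu)) hu

include hle hdis in
theorem mem_piece_of_mem_ker_carnotHom {a : Δ'.Carnot x} (ha : a ∈ (hπ.carnotHom hΔ hΔ').ker) :
    a ∈ (Δ'.carnotGrading x).piece k := by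
  refine (Δ'.carnotGrading x).mem_piece_of_proj_eq_zero fun i hik => ?_
  have hproj : hπ.carnotHom hΔ hΔ' ((Δ'.carnotGrading x).proj i a) = 0 := by
    refine (NegGrading.map_proj _ (Δ.carnotGrading (π x))
      (p := (hπ.carnotHom hΔ hΔ' : Δ'.Carnot x →ₗ[ℝ] Δ.Carnot (π x)))
      (fun _ _ => hπ.carnotHom_mem_piece hΔ hΔ') i a).trans ?_
    exact (congrArg _ ((LieHom.mem_ker (f := hπ.carnotHom hΔ hΔ')).1 ha)).trans (map_zero _)
  obtain ⟨X', hX'⟩ := (Δ'.carnotGrading x).proj_mem i a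
  rw [← hX', ← hΔ'.valueCls_flagEval] at hproj ⊢
  exact hπ.valueCls_eq_zero_of_carnotHom_eq_zero hΔ hΔ' hle hdis hik hproj

/-- The map of `ker d_xπ ⊆ Δ'_k(x)` to the kernel of the homomorphism of Carnot algebras. -/
noncomputable def kerMap : LinearMap.ker (mfderiv 𝓘(ℝ, E') 𝓘(ℝ, E) π x).toLinearMap →ₗ[ℝ]
    (hπ.carnotHom hΔ hΔ').ker :=
  (hΔ'.valueCls k ∘ₗ Submodule.inclusion hle).codRestrict (hπ.carnotHom hΔ hΔ').ker.toSubmodule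
    fun w => (LieHom.mem_ker (f := hπ.carnotHom hΔ hΔ')).2 <|
      (hπ.carnotHom_valueCls_eq_zero_iff hΔ hΔ').2
        ⟨0, Submodule.zero_mem _, by rw [sub_zero]; exact w.2⟩

include hdis in
theorem kerMap_bijective : Function.Bijective (hπ.kerMap hΔ hΔ' hle) := by
  constructor
  · refine (injective_iff_map_eq_zero (hπ.kerMap hΔ hΔ' hle)).2 fun w hw => ?_
    have hw' : hΔ'.valueCls k (Submodule.inclusion hle w) = 0 := congrArg Subtype.val hw
    exact Subtype.ext (Submodule.disjoint_def.1 hdis _ w.2 (hΔ'.valueCls_eq_zero_iff.1 hw'))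
  · rintro ⟨a, ha⟩
    obtain ⟨X', rfl⟩ := hπ.mem_piece_of_mem_ker_carnotHom hΔ hΔ' hle hdis ha
    obtain ⟨u, hu, hvu⟩ := (hπ.carnotHom_valueCls_eq_zero_iff hΔ hΔ' (v := Δ'.flagEval x k X')).1
      (by rw [hΔ'.valueCls_flagEval]; exact (LieHom.mem_ker (f := hπ.carnotHom hΔ hΔ')).1 ha)
    refine ⟨⟨_, hvu⟩, Subtype.ext ?_⟩
    change hΔ'.valueCls k (Submodule.inclusion hle ⟨_, hvu⟩) = Δ'.cls x k X'
    rw [← hΔ'.valueCls_flagEval, ← sub_eq_zero, ← map_sub, hΔ'.valueCls_eq_zero_iff]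
    change Δ'.flagEval x k X' - u - (Δ'.flagEval x k X').1 ∈ Δ'.flag (k - 1) x
    rw [sub_sub_cancel_left]
    exact Submodule.neg_mem _ hu

include hle hdis in
theorem carnotHom_isCentralExtension :
    IsCentralExtension (Δ'.carnotGrading x) (Δ.carnotGrading (π x))
      (Module.finrank ℝ (LinearMap.ker (mfderiv 𝓘(ℝ, E') 𝓘(ℝ, E) π x).toLinearMap)) k
      (hπ.carnotHom hΔ hΔ') where
  surjective := hπ.carnotHom_surjective hΔ hΔ'
  map_piece _ _ := hπ.carnotHom_mem_piece hΔ hΔ'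
  ker_central := NegGrading.lieIdeal_le_center _ fun _ =>
    hπ.mem_piece_of_mem_ker_carnotHom hΔ hΔ' hle hdis
  rank_ker := by
    have : FiniteDimensional ℝ (TangentSpace 𝓘(ℝ, E') x) :=
      inferInstanceAs (FiniteDimensional ℝ E')
    let e := LinearEquiv.ofBijective _ (hπ.kerMap_bijective hΔ hΔ' hle hdis)
    have : Module.Finite ℝ (hπ.carnotHom hΔ hΔ').ker := Module.Finite.equiv e
    rw [← Module.finrank_eq_rank, e.finrank_eq]
  ker_le_piece _ := hπ.mem_piece_of_mem_ker_carnotHom hΔ hΔ' hle hdis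

end PureGrading

end IsFiberwiseIso

namespace NegGrading

open SmoothVF

section FlatModel

variable {𝔪 : Type*} [LieRing 𝔪] [LieAlgebra ℝ 𝔪]

section Degree

variable (G : NegGrading 𝔪)

/-- The subspace `g_{-1} ⊕ ⋯ ⊕ g_{-n}`. -/
noncomputable def lowPart (n : ℕ) : Submodule ℝ 𝔪 := ⨆ j ≤ n, G.piece j

theorem lowPart_mono : Monotone G.lowPart :=
  fun _ _ hmn => biSup_mono fun _ hj => hj.trans hmn

theorem piece_le_lowPart {i n : ℕ} (hin : i ≤ n) : G.piece i ≤ G.lowPart n :=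
  le_biSup G.piece hin

theorem lowPart_one : G.lowPart 1 = G.piece 1 := by
  refine le_antisymm (iSup₂_le fun j hj => ?_) (G.piece_le_lowPart le_rfl)
  interval_cases j
  · rw [G.piece_zero]; exact bot_le
  · exact le_rfl

theorem proj_eq_zero_of_mem_lowPart {n k : ℕ} (hnk : n < k) {X : 𝔪} (hX : X ∈ G.lowPart n) :
    G.proj k X = 0 := by
  have hle : G.lowPart n ≤ LinearMap.ker (G.proj k) :=
    iSup₂_le fun j hj _ hY => G.proj_of_mem_ne (by omega) hY
  exact hle hX

theorem lie_mem_lowPart {n : ℕ} {X Y : 𝔪} (hX : X ∈ G.piece 1) (hY : Y ∈ G.lowPart n) :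
    ⁅X, Y⁆ ∈ G.lowPart (n + 1) := by
  have hle : G.lowPart n ≤ (G.lowPart (n + 1)).comap (LieAlgebra.ad ℝ 𝔪 X) :=
    iSup₂_le fun j hj Z hZ => G.piece_le_lowPart (by omega) (G.lie_mem hX hZ)
  exact hle hY

end Degree

variable [FiniteDimensional ℝ 𝔪] (G : NegGrading 𝔪)

instance : T2Space G.FlatModel := inferInstanceAs (T2Space G.Space)

/-- The map that assigns to an element of `𝔪` its left invariant vector field, as a homomorphism of
Lie algebras. -/
noncomputable def leftInvariantFieldHom : 𝔪 →ₗ⁅ℝ⁆ SmoothVF G.Space G.FlatModel where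
  toFun := G.leftInvariantField
  map_add' X Y := by ext u; exact map_add (G.leftInvariant u) X Y
  map_smul' c X := by ext u; exact map_smul (G.leftInvariant u) c X
  map_lie' {X Y} := by
    ext u
    have hlie : G.lieEquiv ⁅X, Y⁆ = ⁅G.lieEquiv X, G.lieEquiv Y⁆ := G.lieEquiv.map_lie X Y
    rw [GroupLieAlgebra.bracket_def] at hlie
    change mulInvariantVectorField (G.lieEquiv ⁅X, Y⁆) u = _
    rw [hlie]
    exact congrFun (mulInvariantVector_mlieBracket (I := 𝓘(ℝ, G.Space)) (G := G.FlatModel)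
      (G.lieEquiv X) (G.lieEquiv Y)) u

theorem leftInvariant_surjective (u : G.FlatModel) : Function.Surjective (G.leftInvariant u) := by
  have : FiniteDimensional ℝ (TangentSpace 𝓘(ℝ, G.Space) u) :=
    inferInstanceAs (FiniteDimensional ℝ G.Space)
  exact (LinearMap.injective_iff_surjective_of_finrank_eq_finrank rfl).1
    (G.leftInvariant_injective u)

theorem valueAt_map_leftInvariantFieldHom (S : Submodule ℝ 𝔪) (u : G.FlatModel) :
    valueAt (S.map (G.leftInvariantFieldHom : 𝔪 →ₗ[ℝ] SmoothVF G.Space G.FlatModel)) u =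
      S.map (G.leftInvariant u) := by
  ext v
  rw [mem_valueAt]
  constructor
  · rintro ⟨_, ⟨X, hX, rfl⟩, rfl⟩
    exact ⟨X, hX, rfl⟩
  · rintro ⟨X, hX, rfl⟩
    exact ⟨_, ⟨X, hX, rfl⟩, rfl⟩

theorem flag_flatDistribution_le (i : ℕ) (u : G.FlatModel) :
    G.flatDistribution.flag i u ≤ (G.lowPart i).map (G.leftInvariant u) := by
  rw [← valueAt_map_leftInvariantFieldHom]
  refine TangentDistribution.flag_le_valueAt (R := fun n => (G.lowPart n).map
    (G.leftInvariantFieldHom : 𝔪 →ₗ[ℝ] SmoothVF G.Space G.FlatModel))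
    (fun _ _ hij => Submodule.map_mono (G.lowPart_mono hij)) (fun z => ?_) ?_ i u
  · rw [valueAt_map_leftInvariantFieldHom, lowPart_one]
    rfl
  · rintro n _ ⟨X, hX, rfl⟩ _ ⟨Y, hY, rfl⟩
    rw [lowPart_one] at hX
    exact ⟨⁅X, Y⁆, G.lie_mem_lowPart hX hY, G.leftInvariantFieldHom.map_lie X Y⟩

variable {G}

theorem IsFundamental.exists_leftInvariantFieldHom_mem_flagSections (hG : G.IsFundamental)
    (X : 𝔪) : ∃ n, G.leftInvariantFieldHom X ∈ G.flatDistribution.flagSections n := by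
  have hX : X ∈ LieSubalgebra.lieSpan ℝ 𝔪 (G.piece 1 : Set 𝔪) := by rw [hG]; trivial
  induction hX using LieSubalgebra.lieSpan_induction with
  | mem X hX => exact ⟨1, fun u => ⟨X, hX, rfl⟩⟩
  | zero =>
    refine ⟨0, ?_⟩
    rw [map_zero]
    exact Submodule.zero_mem _
  | add X Y _ _ hX hY =>
    obtain ⟨⟨m, hm⟩, n, hn⟩ := And.intro hX hY
    refine ⟨max m n, ?_⟩
    rw [map_add]
    exact Submodule.add_mem _ (G.flatDistribution.flagSections_mono (le_max_left m n) hm)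
      (G.flatDistribution.flagSections_mono (le_max_right m n) hn)
  | smul c X _ hX =>
    obtain ⟨n, hn⟩ := hX
    refine ⟨n, ?_⟩
    rw [map_smul]
    exact Submodule.smul_mem _ c hn
  | lie X Y _ _ hX hY =>
    obtain ⟨⟨m, hm⟩, n, hn⟩ := And.intro hX hY
    refine ⟨m + n, ?_⟩
    rw [LieHom.map_lie]
    exact G.flatDistribution.lie_mem hm hn

theorem IsFundamental.isCompletelyNonholonomic (hG : G.IsFundamental) :
    G.flatDistribution.IsCompletelyNonholonomic := by
  choose n hn using hG.exists_leftInvariantFieldHom_mem_flagSections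
  let b := Module.finBasis ℝ 𝔪
  refine ⟨Finset.univ.sup fun i => n (b i), fun u => eq_top_iff.2 ?_⟩
  rw [← LinearMap.range_eq_top.2 (G.leftInvariant_surjective u), LinearMap.range_eq_map,
    ← b.span_eq, Submodule.map_span_le]
  rintro _ ⟨i, rfl⟩
  exact G.flatDistribution.flag_mono (Finset.le_sup (f := fun i => n (b i)) (Finset.mem_univ i)) u
    (G.flatDistribution.apply_mem_flag (hn (b i)) u)

end FlatModel

section Morphism

variable {𝔫 𝔪 : Type*} [LieRing 𝔫] [LieAlgebra ℝ 𝔫] [FiniteDimensional ℝ 𝔫]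
  [LieRing 𝔪] [LieAlgebra ℝ 𝔪] [FiniteDimensional ℝ 𝔪]
  {H : NegGrading 𝔫} {G : NegGrading 𝔪} {p : 𝔫 →ₗ⁅ℝ⁆ 𝔪}

theorem map_degree (hp : ∀ i, ∀ X ∈ H.piece i, p X ∈ G.piece i) (v : 𝔫) :
    p (H.degree v) = G.degree (p v) := by
  induction v using H.piece_induction with
  | zero => simp
  | add a b ha hb => simp only [map_add, ha, hb]
  | mem i v hv => rw [H.degree_of_mem hv, G.degree_of_mem (hp i v hv), map_smul]

theorem map_frameAux (hp : ∀ i, ∀ X ∈ H.piece i, p X ∈ G.piece i) (u v : 𝔫) (s : ℕ) :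
    p (H.frameAux u s v) = G.frameAux (p u) s (p v) := by
  induction s using Nat.strong_induction_on with
  | _ s ih =>
  rcases s with _ | s
  · rw [frameAux, frameAux]; rfl
  · simp only [frameAux_succ, LinearMap.smul_apply, LinearMap.sum_apply, LinearMap.comp_apply,
      LieAlgebra.ad_apply, map_smul, map_sum, LieHom.map_lie]
    congr 1
    refine Finset.sum_congr rfl fun l _ => ?_
    rw [ih _ (by omega)]
    exact congrArg (⁅·, _⁆) (map_proj H G (p := (p : 𝔫 →ₗ[ℝ] 𝔪)) hp (l + 1) u)

theorem map_frame (hp : ∀ i, ∀ X ∈ H.piece i, p X ∈ G.piece i) (u v : 𝔫) :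
    p (H.frame u v) = G.frame (p u) (p v) := by
  rw [H.frame_apply u v (le_max_left H.depth G.depth),
    G.frame_apply _ _ (le_max_right H.depth G.depth), map_sum]
  exact Finset.sum_congr rfl fun s _ => map_frameAux hp u v s

/-- The homomorphism of Lie groups that integrates a homomorphism of graded Lie algebras. In the
coordinates of the flat models, which are the Lie algebras themselves, it is the same map. -/
noncomputable def flatModelHom (hp : ∀ i, ∀ X ∈ H.piece i, p X ∈ G.piece i) :
    H.FlatModel →* G.FlatModel where
  toFun := fun u : 𝔫 => p u
  map_one' := map_zero p
  map_mul' := fun u v : 𝔫 => by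
    change p (u + H.frame u v) = p u + G.frame (p u) (p v)
    rw [map_add, map_frame hp]

variable (H G) in
/-- A linear map `𝔫 → 𝔪` as a continuous linear map of the model spaces of the flat models. -/
noncomputable def spaceMap (p : 𝔫 →ₗ[ℝ] 𝔪) : H.Space →L[ℝ] G.Space :=
  LinearMap.toContinuousLinearMap (G.toSpace.toLinearMap ∘ₗ p ∘ₗ H.toSpace.symm.toLinearMap)

theorem contMDiff_flatModelHom (hp : ∀ i, ∀ X ∈ H.piece i, p X ∈ G.piece i) :
    ContMDiff 𝓘(ℝ, H.Space) 𝓘(ℝ, G.Space) ∞ (flatModelHom hp) :=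
  (spaceMap H G p).contMDiff

theorem mfderiv_flatModelHom_apply (hp : ∀ i, ∀ X ∈ H.piece i, p X ∈ G.piece i) (u : H.FlatModel)
    (v : 𝔫) : mfderiv 𝓘(ℝ, H.Space) 𝓘(ℝ, G.Space) (flatModelHom hp) u v = p v :=
  congrArg (fun L : H.Space →L[ℝ] G.Space => L v)
    ((spaceMap H G p).hasMFDerivAt (x := H.toModel.symm u)).mfderiv

theorem mfderiv_flatModelHom_leftInvariant (hp : ∀ i, ∀ X ∈ H.piece i, p X ∈ G.piece i)
    (u : H.FlatModel) (X : 𝔫) :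
    mfderiv 𝓘(ℝ, H.Space) 𝓘(ℝ, G.Space) (flatModelHom hp) u (H.leftInvariant u X) =
      G.leftInvariant (flatModelHom hp u) (p X) := by
  rw [leftInvariant_apply, leftInvariant_apply]
  refine (mfderiv_flatModelHom_apply hp u _).trans ((map_frame hp _ _).trans ?_)
  exact congrArg (G.frame _) (map_degree hp X)

theorem mfderiv_flatModelHom_leftInvariant_eq_zero_iff
    (hp : ∀ i, ∀ X ∈ H.piece i, p X ∈ G.piece i) (u : H.FlatModel) (X : 𝔫) :
    mfderiv 𝓘(ℝ, H.Space) 𝓘(ℝ, G.Space) (flatModelHom hp) u (H.leftInvariant u X) = 0 ↔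
      p X = 0 := by
  rw [mfderiv_flatModelHom_leftInvariant hp]
  exact map_eq_zero_iff _ (G.leftInvariant_injective _)

end Morphism

end NegGrading

namespace IsCentralExtension

open NegGrading

variable {𝔫 𝔪 : Type*} [LieRing 𝔫] [LieAlgebra ℝ 𝔫] [LieRing 𝔪] [LieAlgebra ℝ 𝔪]
  {H : NegGrading 𝔫} {G : NegGrading 𝔪} {d k : ℕ} {p : 𝔫 →ₗ⁅ℝ⁆ 𝔪}

theorem eq_zero_of_mem_lowPart (hp : IsCentralExtension H G d k p) {n : ℕ} (hnk : n < k) {X : 𝔫}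
    (hX : X ∈ H.lowPart n) (hpX : p X = 0) : X = 0 := by
  rw [← H.proj_of_mem (hp.ker_le_piece X ((LieHom.mem_ker (f := p)).2 hpX)),
    H.proj_eq_zero_of_mem_lowPart hnk hX]

theorem exists_mem_piece (hp : IsCentralExtension H G d k p) {i : ℕ} {Y : 𝔪} (hY : Y ∈ G.piece i) :
    ∃ X ∈ H.piece i, p X = Y := by
  obtain ⟨X, rfl⟩ := hp.surjective Y
  exact ⟨H.proj i X, H.proj_mem i X,
    (map_proj H G (p := (p : 𝔫 →ₗ[ℝ] 𝔪)) hp.map_piece i X).trans (G.proj_of_mem hY)⟩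

theorem bijOn_piece (hp : IsCentralExtension H G d k p) {i : ℕ} (hik : i < k) :
    Set.BijOn p (H.piece i) (G.piece i) := by
  refine ⟨hp.map_piece i, fun X hX Y hY hXY => sub_eq_zero.1 ?_, fun Y => hp.exists_mem_piece⟩
  exact hp.eq_zero_of_mem_lowPart hik
    (H.piece_le_lowPart le_rfl (Submodule.sub_mem _ hX hY)) (by rw [map_sub, hXY, sub_self])

variable [FiniteDimensional ℝ 𝔫] [FiniteDimensional ℝ 𝔪]

theorem bijOn_mfderiv_flatModelHom (hp : IsCentralExtension H G d k p) (hk : 1 < k)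
    (u : H.FlatModel) :
    Set.BijOn (mfderiv 𝓘(ℝ, H.Space) 𝓘(ℝ, G.Space) (flatModelHom hp.map_piece) u)
      (H.flatDistribution.space u) (G.flatDistribution.space (flatModelHom hp.map_piece u)) := by
  have hd := mfderiv_flatModelHom_leftInvariant hp.map_piece u
  have hbij := hp.bijOn_piece hk
  refine ⟨?_, ?_, ?_⟩
  · rintro _ ⟨X, hX, rfl⟩
    exact ⟨p X, hbij.mapsTo hX, (hd X).symm⟩
  · rintro _ ⟨X, hX, rfl⟩ _ ⟨Y, hY, rfl⟩ hXY
    rw [hd, hd] at hXY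
    rw [hbij.injOn hX hY (G.leftInvariant_injective _ hXY)]
  · rintro _ ⟨Y, hY, rfl⟩
    obtain ⟨X, hX, rfl⟩ := hbij.surjOn hY
    exact ⟨_, ⟨X, hX, rfl⟩, hd X⟩

theorem disjoint_flag_ker_mfderiv_flatModelHom (hp : IsCentralExtension H G d k p) {n : ℕ}
    (hnk : n < k) (u : H.FlatModel) :
    Disjoint (H.flatDistribution.flag n u) (LinearMap.ker
      (mfderiv 𝓘(ℝ, H.Space) 𝓘(ℝ, G.Space) (flatModelHom hp.map_piece) u).toLinearMap) := by
  refine Submodule.disjoint_def.2 fun v hv hv0 => ?_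
  obtain ⟨X, hX, rfl⟩ := H.flag_flatDistribution_le n u hv
  rw [hp.eq_zero_of_mem_lowPart hnk hX
    ((mfderiv_flatModelHom_leftInvariant_eq_zero_iff hp.map_piece u X).1 hv0), map_zero]

theorem isIntegrableExtension_flatModelHom (hp : IsCentralExtension H G d k p) (hk : 2 < k) :
    IsIntegrableExtension H.flatDistribution G.flatDistribution (flatModelHom hp.map_piece) where
  contMDiff := contMDiff_flatModelHom hp.map_piece
  submersion u w := by
    obtain ⟨v, hv⟩ := hp.surjective w
    exact ⟨v, (mfderiv_flatModelHom_apply hp.map_piece u v).trans hv⟩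
  bijOn := hp.bijOn_mfderiv_flatModelHom (by omega)
  flag_two := hp.disjoint_flag_ker_mfderiv_flatModelHom hk

end IsCentralExtension

theorem mainTheorem10_general :
    (∀ {E' : Type*} [NormedAddCommGroup E'] [NormedSpace ℝ E'] [FiniteDimensional ℝ E']
      {M' : Type*} [TopologicalSpace M'] [ChartedSpace E' M'] [IsManifold 𝓘(ℝ, E') ∞ M']
      [T2Space M']
      {E : Type*} [NormedAddCommGroup E] [NormedSpace ℝ E] [FiniteDimensional ℝ E]
      {M : Type*} [TopologicalSpace M] [ChartedSpace E M] [IsManifold 𝓘(ℝ, E) ∞ M] [T2Space M]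
      (Δ' : TangentDistribution E' M') (Δ : TangentDistribution E M) (π : M' → M)
      (x : M') (k : ℕ),
      Δ.IsRegularAt (π x) → Δ'.IsRegularAt x → IsFiberwiseIso Δ' Δ π →
      LinearMap.ker (mfderiv 𝓘(ℝ, E') 𝓘(ℝ, E) π x).toLinearMap ≤ Δ'.flag k x →
      Disjoint (LinearMap.ker (mfderiv 𝓘(ℝ, E') 𝓘(ℝ, E) π x).toLinearMap) (Δ'.flag (k - 1) x) →
      ∃ p : Δ'.Carnot x →ₗ⁅ℝ⁆ Δ.Carnot (π x),
        IsCentralExtension (Δ'.carnotGrading x) (Δ.carnotGrading (π x))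
          (Module.finrank ℝ (LinearMap.ker (mfderiv 𝓘(ℝ, E') 𝓘(ℝ, E) π x).toLinearMap)) k p ∧
        ∀ (i : ℕ) (X' : Δ'.flagSections i) (X : Δ.flagSections i),
          mfderiv 𝓘(ℝ, E') 𝓘(ℝ, E) π x (X'.1.1 x) = X.1.1 (π x) →
            p (Δ'.cls x i X') = Δ.cls (π x) i X) ∧
    (∀ {𝔫 : Type*} [LieRing 𝔫] [LieAlgebra ℝ 𝔫] [FiniteDimensional ℝ 𝔫]
      {𝔪 : Type*} [LieRing 𝔪] [LieAlgebra ℝ 𝔪] [FiniteDimensional ℝ 𝔪]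
      (H : NegGrading 𝔫) (G : NegGrading 𝔪) (d k : ℕ) (p : 𝔫 →ₗ⁅ℝ⁆ 𝔪),
      IsCentralExtension H G d k p → 2 < k →
      ∃ π : H.FlatModel →* G.FlatModel,
        IsIntegrableExtension H.flatDistribution G.flatDistribution π ∧
        (∀ (u : H.FlatModel) (X : 𝔫),
          mfderiv 𝓘(ℝ, H.Space) 𝓘(ℝ, G.Space) π u (H.leftInvariant u X) =
            G.leftInvariant (π u) (p X)) ∧
        (H.IsFundamental → H.flatDistribution.IsCompletelyNonholonomic)) := by
  constructor
  · intro E' _ _ _ M' _ _ _ _ E _ _ _ M _ _ _ _ Δ' Δ π x k hΔ hΔ' hπ hle hdis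
    exact ⟨hπ.carnotHom hΔ hΔ', hπ.carnotHom_isCentralExtension hΔ hΔ' hle hdis,
      fun _ _ _ hXX' => hπ.carnotHom_cls_eq hΔ hΔ' hXX'⟩
  · intro 𝔫 _ _ _ 𝔪 _ _ _ H G d k p hp hk
    exact ⟨NegGrading.flatModelHom hp.map_piece, hp.isIntegrableExtension_flatModelHom hk,
      NegGrading.mfderiv_flatModelHom_leftInvariant hp.map_piece,
      fun hH => hH.isCompletelyNonholonomic⟩

theorem mainTheorem10 :
    (∀ {E' : Type*} [NormedAddCommGroup E'] [NormedSpace ℝ E'] [FiniteDimensional ℝ E']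
      {M' : Type*} [TopologicalSpace M'] [ChartedSpace E' M'] [IsManifold 𝓘(ℝ, E') ∞ M'] [T2Space M']
      {E : Type*} [NormedAddCommGroup E] [NormedSpace ℝ E] [FiniteDimensional ℝ E]
      {M : Type*} [TopologicalSpace M] [ChartedSpace E M] [IsManifold 𝓘(ℝ, E) ∞ M] [T2Space M]
      (Δ' : TangentDistribution E' M') (Δ : TangentDistribution E M) (π : M' → M)
      (x : M') (d k : ℕ),
      Δ.IsRegular → Δ'.IsRegular →
      Δ.IsCompletelyNonholonomic → Δ'.IsCompletelyNonholonomic →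
      IsIntegrableExtension Δ' Δ π →
      Module.finrank ℝ (LinearMap.ker (mfderiv 𝓘(ℝ, E') 𝓘(ℝ, E) π x).toLinearMap) = d →
      2 < k →
      LinearMap.ker (mfderiv 𝓘(ℝ, E') 𝓘(ℝ, E) π x).toLinearMap ≤ Δ'.flag k x →
      Disjoint (LinearMap.ker (mfderiv 𝓘(ℝ, E') 𝓘(ℝ, E) π x).toLinearMap) (Δ'.flag (k - 1) x) →
      ∃ p : Δ'.Carnot x →ₗ⁅ℝ⁆ Δ.Carnot (π x),
        IsCentralExtension (Δ'.carnotGrading x) (Δ.carnotGrading (π x)) d k p ∧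
        ∀ (i : ℕ) (X' : Δ'.flagSections i) (X : Δ.flagSections i),
          mfderiv 𝓘(ℝ, E') 𝓘(ℝ, E) π x (X'.1.1 x) = X.1.1 (π x) →
            p (Δ'.cls x i X') = Δ.cls (π x) i X) ∧
    (∀ {𝔫 : Type*} [LieRing 𝔫] [LieAlgebra ℝ 𝔫] [FiniteDimensional ℝ 𝔫]
      {𝔪 : Type*} [LieRing 𝔪] [LieAlgebra ℝ 𝔪] [FiniteDimensional ℝ 𝔪]
      (H : NegGrading 𝔫) (G : NegGrading 𝔪) (d k : ℕ) (p : 𝔫 →ₗ⁅ℝ⁆ 𝔪),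
      G.IsFundamental → IsCentralExtension H G d k p → ¬ IsTrivialExtension p → 2 < k →
      ∃ π : H.FlatModel →* G.FlatModel,
        IsIntegrableExtension H.flatDistribution G.flatDistribution π ∧
        (∀ (u : H.FlatModel) (X : 𝔫),
          mfderiv 𝓘(ℝ, H.Space) 𝓘(ℝ, G.Space) π u (H.leftInvariant u X) =
            G.leftInvariant (π u) (p X)) ∧
        (H.IsFundamental → H.flatDistribution.IsCompletelyNonholonomic)) := by
  obtain ⟨hpart₁, hpart₂⟩ := mainTheorem10_general
  refine ⟨?_, fun H G d k p _ hp _ hk => hpart₂ H G d k p hp hk⟩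
  rintro E' _ _ _ M' _ _ _ _ E _ _ _ M _ _ _ _ Δ' Δ π x _ k hΔ hΔ' - - hπ rfl - hle hdis
  exact hpart₁ Δ' Δ π x k (hΔ.isRegularAt (π x)) (hΔ'.isRegularAt x) hπ.isFiberwiseIso hle hdis
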